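/- **Setting.** Fix $n\ge 0$. Let $\mathcal C^n(\mathbb R)$ be the set of continuous $f=(f_1,\dots,f_n):\mathbb R\to\mathbb R^n$ for which there is $\lambda(f)\in\mathbb R^n$ with $f(x)/x\to\lambda(f)$ both as $x\to+\infty$ and as $x\to-\infty$. Let $\mathcal C^n_{\le},\mathcal C^n_{\ge},\mathcal C^n_{<},\mathcal C^n_{>}$ be the subsets of those $f$ for which $\lambda(f)$ is nondecreasing, nonincreasing, strictly increasing, strictly decreasing, respectively. Put $Rf(x)=f(-x)$. For $1\le i<n$ define $\mathcal P_{\tau_i}$ as follows. If $\lambda(f)_i\ge\lambda(f)_{i+1}$, then $\mathcal P_{\tau_i}f=f$. If $\lambda(f)_i<\lambda(f)_{i+1}$, then $\mathcal P_{\tau_i}$ replaces $f_i(x)$ by $f_i(x)+S(x)$ and $f_{i+1}(x)$ by $f_{i+1}(x)-S(x)$, where $S(x)=\sup_{z\le x}[f_{i+1}(z)-f_i(z)]$, and leaves the other lines unchanged. Let $\mathcal P_{\bar\tau_i}=R\,\mathcal P_{\tau_i}R$, and let $O(f)$ be the set of images of $f$ under all finite compositions of the maps $\mathcal P_{\tau_i},\mathcal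 P_{\bar\tau_i}$. A path from $(x,a)$ to $(y,b)$, where $x\le y$, is a nonincreasing right-continuous $\pi:[x,y]\to\{b,\dots,a\}$. Its length is $\|\pi\|_f=\sum_{i=b}^a [f_i(t_{i-1})-f_i(t_i)]$, where $t_i=\inf\{t\in[x,y]:\pi(t)\le i\}$ (equal to $y$ if there is no such $t$). For $\mathbf m=(m_1<\dots<m_k)$ in $\{1,\dots,n\}$ and $t<x$, let $f[(t,\mathbf m)\to(x^k,1)]$ be the supremum of $\sum_{j=1}^k\|\pi_j\|_f$ over all $k$-tuples of paths $\pi_j$ from $(t,m_j)$ to $(x,1)$ with $\pi_j<\pi_{j+1}$ on $(t,x)$ for $1\le j<k$, and let $$f[(-\infty,\mathbf m)\to(x^k,1)]=\lim_{t\to-\infty}\Big(f[(t,\mathbf m)\to(x^k,1)]+\sum_{j=1}^k f_{m_j}(t)\Big)$$ when this limit exists. For $\lambda\in\mathbb R^n$, call $\mathbf m$ *$\lambda$-admissible* if $\lambda_{p-1}<\lambda_p$ whenever $p\ge2$ is a coordinate of $\mathbf m$ and $p-1$ is not. **Theorem.** 1. For each $f\in\mathcal C^n_\le$ there is exactly one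 $g=\mathcal P_{\mathrm{RSK}}f\in O(f)\cap\mathcal C^n_\ge$, and for each $g\in\mathcal C^n_\ge$ there is exactly one $\mathcal Q_{\mathrm{RSK}}g\in O(g)\cap\mathcal C^n_\le$. The maps $\mathcal P_{\mathrm{RSK}}:\mathcal C^n_\le\to\mathcal C^n_\ge$ and $\mathcal Q_{\mathrm{RSK}}:\mathcal C^n_\ge\to\mathcal C^n_\le$ are mutually inverse bijections, $\mathcal Q_{\mathrm{RSK}}=R\,\mathcal P_{\mathrm{RSK}}R$, and $\mathcal P_{\mathrm{RSK}}R$ is an involution of $\mathcal C^n_\ge$ (the analogue of the Schützenberger involution). 2. (Analogue of Greene's theorem.) Let $f\in\mathcal C^n_\le$, $g=\mathcal P_{\mathrm{RSK}}f$ and $0\le k\le n$. Among the $\lambda(f)$-admissible vectors of length $k$ there is a coordinatewise greatest one, $\mathbf n_k$; among the $(-\lambda(f)_n,\dots,-\lambda(f)_1)$-admissible vectors of length $k$ there is a coordinatewise greatest one, $\mathbf m_k$. For all $x\in\mathbb R$ the following last passage values exist and satisfy $$f[(-\infty,\mathbf n_k)\to(x^k,1)]=g_1(x)+\dots+g_k(x),\qquad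 Rg[(-\infty,\mathbf m_k)\to((-x)^k,1)]=f_1(x)+\dots+f_k(x).$$ 3. For $f\in\mathcal C^n_<$ the limits in $$\sum_{i=1}^k (Wf)_i(x)=f[(-\infty,(n-k+1,\dots,n))\to(x^k,1)],\qquad 0\le k\le n,\ x\in\mathbb R,$$ exist, so that this formula defines $Wf$, and $Wf=\mathcal P_{\mathrm{RSK}}f$. The map $W$ is a bijection from $\mathcal C^n_<$ onto $\mathcal C^n_>$ with inverse $RWR:\mathcal C^n_>\to\mathcal C^n_<$. -/

import Mathlib

open Filter Topology Set

noncomputable section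

namespace RSKLine

/-- An environment of `n` lines: line `i + 1` of the mathematical notation is `f ⟨i, _⟩`. -/
abbrev Env (n : ℕ) : Type := Fin n → ℝ → ℝ

/-- `f` has asymptotic slope vector `lam`: `f(x) / x → lam`, both as `x → +∞` and as `x → -∞`. -/
def HasSlope {n : ℕ} (f : Env n) (lam : Fin n → ℝ) : Prop :=
  ∀ i, Tendsto (fun x => f i x / x) atTop (𝓝 (lam i)) ∧
    Tendsto (fun x => f i x / x) atBot (𝓝 (lam i))

/-- The space `𝒞ⁿ(ℝ)` of continuous functions `ℝ → ℝⁿ` with an asymptotic slope. -/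
def C (n : ℕ) : Set (Env n) :=
  {f | (∀ i, Continuous (f i)) ∧ ∃ lam, HasSlope f lam}

/-- The slope vector `λ(f)`, meaningful for `f ∈ C n`. -/
def asympSlope {n : ℕ} (f : Env n) : Fin n → ℝ :=
  fun i => limUnder atTop (fun x => f i x / x)

/-- Environments with nondecreasing slopes. -/
def CLE (n : ℕ) : Set (Env n) := {f | f ∈ C n ∧ Monotone (asympSlope f)}

/-- Environments with nonincreasing slopes. -/
def CGE (n : ℕ) : Set (Env n) := {f | f ∈ C n ∧ Antitone (asympSlope f)}

/-- Environments with strictly increasing slopes. -/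
def CLT (n : ℕ) : Set (Env n) := {f | f ∈ C n ∧ StrictMono (asympSlope f)}

/-- Environments with strictly decreasing slopes. -/
def CGT (n : ℕ) : Set (Env n) := {f | f ∈ C n ∧ StrictAnti (asympSlope f)}

/-- The reflection `Rf(x) = f(-x)`. -/
def R {n : ℕ} (f : Env n) : Env n := fun i x => f i (-x)

/-! ### Pitman operators and their orbits -/

open Classical in
/-- The Pitman operator acting on the lines `a` and `b` (used for `b = a + 1`): the identity if
`λ_a ≥ λ_b`; otherwise `sup_{z ≤ x} (f_b(z) - f_a(z))` is added to `f_a(x)` and subtracted from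
`f_b(x)`. -/
def pitman {n : ℕ} (a b : Fin n) : Function.End (Env n) := fun f =>
  if asympSlope f a < asympSlope f b then
    fun i x =>
      if i = a then f a x + ⨆ z : Iic x, (f b z - f a z)
      else if i = b then f b x - ⨆ z : Iic x, (f b z - f a z)
      else f i x
  else f

/-- The co-Pitman operator, `R ∘ pitman ∘ R`. -/
def coPitman {n : ℕ} (a b : Fin n) : Function.End (Env n) := fun f => R (pitman a b (R f))

/-- The monoid of maps generated by the Pitman and co-Pitman operators on adjacent lines. -/
def pitmanMonoid (n : ℕ) : Submonoid (Function.End (Env n)) :=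
  Submonoid.closure
    {P | ∃ a b : Fin n, (a : ℕ) + 1 = b ∧ (P = pitman a b ∨ P = coPitman a b)}

/-- The orbit `O(f)` of `f` under all compositions of (co-)Pitman operators. -/
def orbit {n : ℕ} (f : Env n) : Set (Env n) := {g | ∃ P ∈ pitmanMonoid n, g = P f}

/-- The element of the orbit of `f` with nonincreasing slopes. -/
def PRSK {n : ℕ} (f : Env n) : Env n :=
  Classical.epsilon fun g => g ∈ orbit f ∧ g ∈ CGE n

/-- The element of the orbit of `g` with nondecreasing slopes. -/
def QRSK {n : ℕ} (g : Env n) : Env n :=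
  Classical.epsilon fun f => f ∈ orbit g ∧ f ∈ CLE n

/-! ### Last passage percolation -/

/-- `π`, restricted to `[x, y]`, is a path from `(x, a)` to `(y, b)`: a nonincreasing
right-continuous function `[x, y] → {b, …, a}`. -/
structure IsPath {n : ℕ} (π : ℝ → Fin n) (x : ℝ) (a : Fin n) (y : ℝ) (b : Fin n) : Prop where
  le : x ≤ y
  antitone : AntitoneOn π (Icc x y)
  rightCont : ∀ t ∈ Icc x y, ContinuousWithinAt π (Icc t y) t
  mem : ∀ t ∈ Icc x y, b ≤ π t ∧ π t ≤ a

/-- The time `t_i = inf {t ∈ [x, y] : π(t) ≤ i}` at which `π` reaches line `i` or passes it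
(the infimum is taken in `[x, y]`, so it is `y` if there is no such time). -/
def timeLE {n : ℕ} (π : ℝ → Fin n) (x y : ℝ) (i : Fin n) : ℝ :=
  sInf (insert y {t | t ∈ Icc x y ∧ π t ≤ i})

/-- The time `t_{i-1} = inf {t ∈ [x, y] : π(t) ≤ i - 1}` (in `[x, y]`), at which `π` leaves
line `i`. -/
def timeLT {n : ℕ} (π : ℝ → Fin n) (x y : ℝ) (i : Fin n) : ℝ :=
  sInf (insert y {t | t ∈ Icc x y ∧ π t < i})

/-- The length `∑_{i=b}^a (f_i(t_{i-1}) - f_i(t_i))` of a path from `(x, a)` to `(y, b)`. -/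
def pathLength {n : ℕ} (f : Env n) (π : ℝ → Fin n) (x : ℝ) (a : Fin n) (y : ℝ) (b : Fin n) : ℝ :=
  ∑ i ∈ Finset.Icc b a, (f i (timeLT π x y i) - f i (timeLE π x y i))

/-- Disjoint `k`-tuples of paths from `(x, a)` to `(y, b)`. -/
structure IsDisjointTuple {n k : ℕ} (π : Fin k → ℝ → Fin n)
    (x : Fin k → ℝ) (a : Fin k → Fin n) (y : Fin k → ℝ) (b : Fin k → Fin n) : Prop where
  isPath : ∀ j, IsPath (π j) (x j) (a j) (y j) (b j)
  disjoint : ∀ i j : Fin k, (i : ℕ) + 1 = j →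
    ∀ t ∈ Ioo (x i) (y i) ∩ Ioo (x j) (y j), π i t < π j t

/-- The multi-path last passage value `f[(x, a) → (y, b)]`. -/
def lpp {n k : ℕ} (f : Env n)
    (x : Fin k → ℝ) (a : Fin k → Fin n) (y : Fin k → ℝ) (b : Fin k → Fin n) : ℝ :=
  sSup {L | ∃ π : Fin k → ℝ → Fin n, IsDisjointTuple π x a y b ∧
    L = ∑ j, pathLength f (π j) (x j) (a j) (y j) (b j)}

/-- `f[(t, m) → (x^k, 1)] + ∑_i f_{m_i}(t)`, whose limit as `t → -∞` is the last passage value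
`f[(-∞, m) → (x^k, 1)]`. -/
def lppFrom {n k : ℕ} (f : Env n) (m : Fin k → Fin n) (x t : ℝ) : ℝ :=
  lpp f (fun _ => t) m (fun _ => x) (fun j => ⟨0, (m j).pos⟩) + ∑ j, f (m j) t

/-- `f[(-∞, m) → (x^k, 1)] = v`: the limit defining the left-hand side exists and equals `v`. -/
def HasLppFromBot {n k : ℕ} (f : Env n) (m : Fin k → Fin n) (x v : ℝ) : Prop :=
  Tendsto (lppFrom f m x) atBot (𝓝 v)

/-- The set of `m ∈ {1, …, n}^k_<` such that, whenever `p` is a coordinate of `m` and the line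
`q = p - 1` exists but is not a coordinate of `m`, one has `lam_q < lam_p`. -/
def admissible {n : ℕ} (lam : Fin n → ℝ) (k : ℕ) : Set (Fin k → Fin n) :=
  {m | StrictMono m ∧
    ∀ p q : Fin n, (q : ℕ) + 1 = p → p ∈ range m → q ∉ range m → lam q < lam p}

/-- The vector `(n - k + 1, …, n)` of the last `k` lines. -/
def lastLines (n k : ℕ) (hk : k ≤ n) : Fin k → Fin n :=
  fun j => ⟨n - k + j, by omega⟩

/-- The map `W`, determined by
`∑_{i ≤ k} (Wf)_i(x) = f[(-∞, (n - k + 1, …, n)) → (x^k, 1)]` for `k = 0, …, n`. -/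
def W {n : ℕ} (f : Env n) : Env n := fun i x =>
  limUnder atBot (lppFrom f (lastLines n (i + 1) i.isLt) x) -
    limUnder atBot (lppFrom f (lastLines n i i.isLt.le) x)

end RSKLine

end

/-!
A Pitman operator reflects the difference `h = f_b - f_a` of two adjacent lines in its running
maximum `S`, turning `h` into `h - 2S`. Run backwards in time, the reflected difference has running
maximum `-S`, so the co-Pitman operator undoes the Pitman operator. Hence lying in the same orbit is
an equivalence relation, and sorting the slopes shows that every orbit meets `CGE n`.

Last passage values from `-∞` that start at the `k` lines of largest slope are constant along
orbits. With all other jump times fixed, the jump times between the two lines range over disjoint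
intervals `[u, v]`, and the Pitman operator changes the best jump in such an interval only by
`S u + S v`; these changes cancel against the rest of the path weights. The values near `-∞` are
compared at the record times `h = S`, where the operator merely exchanges the values of the two
lines. An element of `CGE n` has the first `k` lines as lines of largest slope, and from there the
last passage value is the sum of the first `k` lines. So an orbit determines its element of
`CGE n`, and the formulas for `PRSK` and `W` are this invariance, written out in an element of
`CLE n`.
-/

namespace RSKLine

/-! ### Running maxima -/

/-- `S x` is the maximum of `h` over `(-∞, x]`. The Pitman operators add and subtract the running
maximum of the difference of two lines. -/
structure IsRunMax {α β : Type*} [Preorder α] [Preorder β] (h S : α → β) : Prop where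
  le : ∀ ⦃z x⦄, z ≤ x → h z ≤ S x
  attained : ∀ x, ∃ z ≤ x, h z = S x

namespace IsRunMax

section Order

variable {α β : Type*}

theorem mono [Preorder α] [Preorder β] {h S : α → β} (H : IsRunMax h S) : Monotone S := by
  intro x y hxy
  obtain ⟨z, hz, hS⟩ := H.attained x
  exact hS ▸ H.le (hz.trans hxy)

theorem iSup_eq [Preorder α] [ConditionallyCompleteLattice β] {h S : α → β} (H : IsRunMax h S)
    (x : α) : ⨆ z : Iic x, h z = S x := by
  obtain ⟨z, hz, hS⟩ := H.attained x
  exact IsGreatest.csSup_eq ⟨⟨⟨z, hz⟩, hS⟩, by rintro _ ⟨w, rfl⟩; exact H.le w.2⟩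

theorem exists_eq_of_lt [LinearOrder α] [Preorder β] {h S : α → β} (H : IsRunMax h S) {u v : α}
    (hlt : S u < S v) : ∃ z ∈ Icc u v, h z = S v := by
  obtain ⟨z, hz, hS⟩ := H.attained v
  refine ⟨z, ⟨?_, hz⟩, hS⟩
  by_contra! hzu
  exact (hS ▸ hlt).not_ge (H.le hzu.le)

theorem frequently_eq [Preorder α] [IsCodirectedOrder α] [Nonempty α] [PartialOrder β]
    {h S : α → β} (H : IsRunMax h S) : ∃ᶠ t in atBot, h t = S t := by
  rw [frequently_atBot]
  intro x
  obtain ⟨z, hz, hS⟩ := H.attained x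
  exact ⟨z, hz, (H.le le_rfl).antisymm (hS ▸ H.mono hz)⟩

end Order

section Topology

variable {α β : Type*} [ConditionallyCompleteLinearOrder α] [TopologicalSpace α] [OrderTopology α]
  [LinearOrder β] [TopologicalSpace β] [OrderTopology β] {h S : α → β}

theorem exists_of_tendsto_atBot [Nonempty α] (hc : Continuous h)
    (hb : Tendsto h atBot atBot) : ∃ S, IsRunMax h S := by
  have hmax : ∀ x, ∃ z ≤ x, ∀ w ≤ x, h w ≤ h z := by
    intro x
    obtain ⟨T, hT⟩ := eventually_atBot.1 (hb.eventually (eventually_le_atBot (h x)))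
    obtain ⟨z, hz, hmax⟩ := (isCompact_Icc (a := min T x) (b := x)).exists_isMaxOn
      ⟨x, min_le_right _ _, le_rfl⟩ hc.continuousOn
    refine ⟨z, hz.2, fun w hw => ?_⟩
    rcases le_total (min T x) w with hTw | hTw
    · exact hmax ⟨hTw, hw⟩
    · exact (hT w (hTw.trans (min_le_left _ _))).trans (hmax ⟨min_le_right _ _, le_rfl⟩)
  choose z hz hmax using hmax
  exact ⟨fun x => h (z x), fun w x hw => hmax x w hw, fun x => ⟨z x, hz x, rfl⟩⟩

theorem continuous (H : IsRunMax h S) (hc : Continuous h) : Continuous S := by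
  refine continuous_iff_continuousAt.2 fun x => tendsto_order.2 ⟨fun c hcx => ?_, fun c hcx => ?_⟩
  · obtain ⟨z, hz, hS⟩ := H.attained x
    have hcz : c < h z := hS ▸ hcx
    rcases hz.eq_or_lt with rfl | hzx
    · filter_upwards [hc.continuousAt.eventually (lt_mem_nhds hcz)] with y hy
      exact hy.trans_le (H.le le_rfl)
    · filter_upwards [lt_mem_nhds hzx] with y hy
      exact hcz.trans_le (H.le hy.le)
  · have hx : ∀ᶠ y in 𝓝 x, h y < c :=
      hc.continuousAt.eventually (gt_mem_nhds ((H.le le_rfl).trans_lt hcx))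
    have hxy : ∀ᶠ y in 𝓝 x, ∀ w ∈ Icc x y, h w < c :=
      (tendsto_const_nhds.Icc tendsto_id).eventually hx.smallSets
    filter_upwards [hxy] with y hy
    obtain ⟨w, hw, hS⟩ := H.attained y
    rcases le_total w x with hwx | hxw
    · exact hS ▸ (H.le hwx).trans_lt hcx
    · exact hS ▸ hy w ⟨hxw, hw⟩

theorem exists_first_hit [DenselyOrdered α] (H : IsRunMax h S) (hc : Continuous h) {u v : α}
    (hlt : S u < S v) : ∃ z ∈ Icc u v, h z = S u ∧ S z = S u := by
  obtain ⟨y, hy, hyS⟩ := H.exists_eq_of_lt hlt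
  have hK : IsCompact (Icc u v ∩ {w | S u ≤ h w}) :=
    isCompact_Icc.inter_right (isClosed_le continuous_const hc)
  obtain ⟨z, ⟨hzI, hzS⟩, hmin⟩ := hK.exists_isLeast ⟨y, hy, hlt.le.trans_eq hyS.symm⟩
  have hz : h z = S u := by
    obtain ⟨w, hw, hwS⟩ := intermediate_value_Icc hzI.1 hc.continuousOn ⟨H.le le_rfl, hzS⟩
    have hzw : z ≤ w := hmin ⟨⟨hw.1, hw.2.trans hzI.2⟩, hwS.ge⟩
    rw [hzw.antisymm hw.2, hwS]
  refine ⟨z, hzI, hz, ((H.mono hzI.1).eq_of_not_lt fun hcon => ?_).symm⟩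
  obtain ⟨w, hw, hwS⟩ := H.exists_eq_of_lt hcon
  have hzw : z ≤ w := hmin ⟨⟨hw.1, hw.2.trans hzI.2⟩, hcon.le.trans_eq hwS.symm⟩
  rw [← hwS, hw.2.antisymm hzw, hz] at hcon
  exact lt_irrefl _ hcon

end Topology

section Reflection

variable {α β : Type*} [CommRing β] [LinearOrder β] [IsStrictOrderedRing β] {h S : α → β}

/-- This lemma and the next one compare the best jump in `[u, v]` between two lines, worth `h`, with
the best jump after the Pitman operator has reflected `h` into `h - 2S`. -/
theorem exists_le_reflected [ConditionallyCompleteLinearOrder α] [TopologicalSpace α]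
    [OrderTopology α] [DenselyOrdered α] [TopologicalSpace β] [OrderTopology β]
    (H : IsRunMax h S) (hc : Continuous h) {u v z : α} (hz : z ∈ Icc u v) :
    ∃ z' ∈ Icc u v, h z ≤ S u + S v + (h z' - 2 * S z') := by
  rcases (H.mono (hz.1.trans hz.2)).eq_or_lt with heq | hlt
  · have hzv : S z ≤ S v := H.mono hz.2
    exact ⟨z, hz, by linarith⟩
  · obtain ⟨w, hw, hhw, hSw⟩ := H.exists_first_hit hc hlt
    have hzv : h z ≤ S v := H.le hz.2
    exact ⟨w, hw, by linarith⟩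

theorem exists_reflected_le [LinearOrder α] (H : IsRunMax h S) {u v z : α} (hz : z ∈ Icc u v) :
    ∃ z' ∈ Icc u v, S u + S v + (h z - 2 * S z) ≤ h z' := by
  have huz : S u ≤ S z := H.mono hz.1
  rcases (H.mono (hz.1.trans hz.2)).eq_or_lt with heq | hlt
  · exact ⟨z, hz, by linarith⟩
  · obtain ⟨w, hw, hhw⟩ := H.exists_eq_of_lt hlt
    have hhz : h z ≤ S z := H.le le_rfl
    exact ⟨w, hw, by linarith⟩

theorem reflected [ConditionallyCompleteLinearOrder α] [TopologicalSpace α] [OrderTopology α]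
    [DenselyOrdered α] [AddCommGroup α] [IsOrderedAddMonoid α]
    [TopologicalSpace β] [OrderTopology β]
    (H : IsRunMax h S) (hc : Continuous h) (ht : Tendsto h atTop atTop) :
    IsRunMax (fun z => h (-z) - 2 * S (-z)) (fun x => -S (-x)) where
  le z x hzx := by
    have hhS : h (-z) ≤ S (-z) := H.le le_rfl
    have hSS : S (-x) ≤ S (-z) := H.mono (neg_le_neg hzx)
    linarith
  attained x := by
    obtain ⟨v, hv⟩ := (ht.eventually (eventually_gt_atTop (S (-x)))).exists
    obtain ⟨z, hz, hhz, hSz⟩ := H.exists_first_hit hc (hv.trans_le (H.le le_rfl))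
    refine ⟨-z, neg_le.1 hz.1, ?_⟩
    simp only [neg_neg, hhz, hSz]
    ring

end Reflection

section Slope

variable {h S : ℝ → ℝ} {μ : ℝ}

theorem tendsto_div_atBot (H : IsRunMax h S) (hμ : 0 < μ)
    (hs : Tendsto (fun x => h x / x) atBot (𝓝 μ)) : Tendsto (fun x => S x / x) atBot (𝓝 μ) := by
  refine tendsto_order.2 ⟨fun c hc => ?_, fun c hc => ?_⟩
  · obtain ⟨d, hd, hdμ⟩ := exists_between (max_lt hc hμ)
    obtain ⟨hcd, hd0⟩ := max_lt_iff.1 hd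
    filter_upwards [eventually_forall_le_atBot.2 (hs.eventually (lt_mem_nhds hdμ)),
      eventually_lt_atBot 0] with x hx hx0
    obtain ⟨z, hz, hS⟩ := H.attained x
    have hdz : S x < d * z := hS ▸ (lt_div_iff_of_neg (hz.trans_lt hx0)).1 (hx z hz)
    refine hcd.trans ((lt_div_iff_of_neg hx0).2 (hdz.trans_le ?_))
    gcongr
  · filter_upwards [hs.eventually (gt_mem_nhds hc), eventually_lt_atBot 0] with x hx hx0
    exact (div_le_div_of_nonpos_of_le hx0.le (H.le le_rfl)).trans_lt hx

theorem tendsto_div_atTop (H : IsRunMax h S) (hμ : 0 < μ)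
    (hs : Tendsto (fun x => h x / x) atTop (𝓝 μ)) : Tendsto (fun x => S x / x) atTop (𝓝 μ) := by
  refine tendsto_order.2 ⟨fun c hc => ?_, fun c hc => ?_⟩
  · filter_upwards [hs.eventually (lt_mem_nhds hc), eventually_gt_atTop 0] with x hx hx0
    exact hx.trans_le (div_le_div_of_nonneg_right (H.le le_rfl) hx0.le)
  · have hc0 : 0 < c := hμ.trans hc
    obtain ⟨T, hT⟩ := eventually_atTop.1 (hs.eventually (gt_mem_nhds hc))
    filter_upwards [eventually_gt_atTop 0, eventually_gt_atTop (S (max T 1) / c)]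
      with x hx0 hxS
    rw [div_lt_iff₀' hc0] at hxS
    rw [div_lt_iff₀ hx0]
    obtain ⟨z, hz, hS⟩ := H.attained x
    rcases le_total z (max T 1) with hzT | hTz
    · exact hS ▸ (H.le hzT).trans_lt hxS
    · obtain ⟨hzT, hz1⟩ := max_le_iff.1 hTz
      have hcz : h z < c * z := (div_lt_iff₀ (one_pos.trans_le hz1)).1 (hT z hzT)
      exact hS ▸ hcz.trans_le (by gcongr)

end Slope

end IsRunMax

theorem tendsto_atTop_of_tendsto_div {h : ℝ → ℝ} {μ : ℝ} (hμ : 0 < μ)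
    (hs : Tendsto (fun x => h x / x) atTop (𝓝 μ)) : Tendsto h atTop atTop := by
  refine (hs.pos_mul_atTop hμ tendsto_id).congr' ?_
  filter_upwards [eventually_ne_atTop 0] with x hx using div_mul_cancel₀ _ hx

theorem tendsto_atBot_of_tendsto_div {h : ℝ → ℝ} {μ : ℝ} (hμ : 0 < μ)
    (hs : Tendsto (fun x => h x / x) atBot (𝓝 μ)) : Tendsto h atBot atBot := by
  refine (hs.pos_mul_atBot hμ tendsto_id).congr' ?_
  filter_upwards [eventually_ne_atBot 0] with x hx using div_mul_cancel₀ _ hx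

/-! ### Jump times of tuples of paths -/

/-- The length of a path in terms of the times `c i` at which it leaves line `i`; so the path spends
the interval `[c (i + 1), c i]` on line `i`. -/
def pathWeight {n : ℕ} (f : Env n) (c : ℕ → ℝ) : ℝ :=
  ∑ i : Fin n, (f i (c i) - f i (c (i + 1)))

/-- The total length of a tuple of paths, in terms of their jump times. -/
def weight {n k : ℕ} (f : Env n) (τ : Fin k → ℕ → ℝ) : ℝ :=
  ∑ j, pathWeight f (τ j)

/-- The arrays of jump times of the disjoint tuples of paths from `(t, m)` to `(x^k, 1)`: `τ j i` is
the time at which the `j`-th path leaves line `i`, and it is `t` on the lines above the starting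
point of the path. -/
structure IsJumpArray {n k : ℕ} (m : Fin k → Fin n) (t x : ℝ) (τ : Fin k → ℕ → ℝ) : Prop where
  zero : ∀ j, τ j 0 = x
  antitone : ∀ j, Antitone (τ j)
  start : ∀ ⦃j i⦄, (m j : ℕ) < i → τ j i = t
  interlace : ∀ i j : Fin k, (i : ℕ) + 1 = j → ∀ r, τ i r ≤ τ j (r + 1)

/-- The set of total lengths of the disjoint tuples of paths from `(t, m)` to `(x^k, 1)`. -/
def weights {n k : ℕ} (f : Env n) (m : Fin k → Fin n) (t x : ℝ) : Set ℝ :=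
  weight f '' {τ | IsJumpArray m t x τ}

/-- Replace row `r` of an array of jump times. -/
def updateRow {k : ℕ} (r : ℕ) (τ : Fin k → ℕ → ℝ) (z : Fin k → ℝ) : Fin k → ℕ → ℝ :=
  fun j => Function.update (τ j) r (z j)

/-- The left end of the interval in which the entry `τ j (r + 1)` of an array of jump times on
`[t, x]` can move when all other rows are fixed. -/
def slotLower {k : ℕ} (r : ℕ) (t x : ℝ) (τ : Fin k → ℕ → ℝ) (j : Fin k) : ℝ :=
  max ((Fin.cons t fun j => τ j r : Fin (k + 1) → ℝ) j.castSucc)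
    ((Fin.snoc (fun j => τ j (r + 2)) x : Fin (k + 1) → ℝ) j.castSucc)

/-- The right end of the interval in which the entry `τ j (r + 1)` of an array of jump times on
`[t, x]` can move when all other rows are fixed. -/
def slotUpper {k : ℕ} (r : ℕ) (t x : ℝ) (τ : Fin k → ℕ → ℝ) (j : Fin k) : ℝ :=
  min ((Fin.cons t fun j => τ j r : Fin (k + 1) → ℝ) j.succ)
    ((Fin.snoc (fun j => τ j (r + 2)) x : Fin (k + 1) → ℝ) j.succ)

theorem cons_castSucc_le_iff {α : Type*} [LE α] {k : ℕ} {u : Fin k → α} {s t : α} (hs : t ≤ s)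
    (j : Fin k) : (Fin.cons t u : Fin (k + 1) → α) j.castSucc ≤ s ↔
      ∀ i : Fin k, (i : ℕ) + 1 = j → u i ≤ s := by
  cases k with
  | zero => exact j.elim0
  | succ k =>
    cases j using Fin.cases with
    | zero => simpa using hs
    | succ j =>
      rw [Fin.castSucc_succ, Fin.cons_succ]
      refine ⟨fun h i hij => ?_, fun h => h _ (by simp)⟩
      rwa [show i = j.castSucc from Fin.ext (by simpa using hij)]

theorem le_snoc_succ_iff {α : Type*} [LE α] {k : ℕ} {u : Fin k → α} {s x : α} (hs : s ≤ x)
    (j : Fin k) : s ≤ (Fin.snoc u x : Fin (k + 1) → α) j.succ ↔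
      ∀ i : Fin k, (j : ℕ) + 1 = i → s ≤ u i := by
  cases k with
  | zero => exact j.elim0
  | succ k =>
    cases j using Fin.lastCases with
    | last => simpa [Fin.succ_last] using ⟨fun _ i hi => by omega, fun _ => hs⟩
    | cast j =>
      rw [Fin.succ_castSucc, Fin.snoc_castSucc]
      refine ⟨fun h i hij => ?_, fun h => h _ (by simp)⟩
      rwa [show i = j.succ from Fin.ext (by simpa using hij.symm)]

theorem slotLower_le_iff {k r : ℕ} {s t x : ℝ} {τ : Fin k → ℕ → ℝ} {j : Fin k} (hs : t ≤ s) :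
    slotLower r t x τ j ≤ s ↔ τ j (r + 2) ≤ s ∧ ∀ i : Fin k, (i : ℕ) + 1 = j → τ i r ≤ s := by
  rw [slotLower, max_le_iff, Fin.snoc_castSucc, cons_castSucc_le_iff hs, and_comm]

theorem le_slotUpper_iff {k r : ℕ} {s t x : ℝ} {τ : Fin k → ℕ → ℝ} {j : Fin k} (hs : s ≤ x) :
    s ≤ slotUpper r t x τ j ↔ s ≤ τ j r ∧ ∀ i : Fin k, (j : ℕ) + 1 = i → s ≤ τ i (r + 2) := by
  rw [slotUpper, le_min_iff, Fin.cons_succ, le_snoc_succ_iff hs]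

/-- The gaps between consecutive slots are the intervals between paired entries of the rows `r` and
`r + 2`, so the ends of the slots are a rearrangement of these two rows. -/
theorem sum_slotLower_add_slotUpper {k : ℕ} (r : ℕ) {t x : ℝ} (htx : t ≤ x) {τ : Fin k → ℕ → ℝ}
    (ht : ∀ j, t ≤ τ j (r + 2)) (hx : ∀ j, τ j r ≤ x) (S : ℝ → ℝ) :
    ∑ j, (S (slotLower r t x τ j) + S (slotUpper r t x τ j)) =
      ∑ j, (S (τ j r) + S (τ j (r + 2))) := by
  set p : Fin (k + 1) → ℝ := Fin.cons t fun j => τ j r with hp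
  set q : Fin (k + 1) → ℝ := Fin.snoc (fun j => τ j (r + 2)) x with hq
  have hlast : max (p (Fin.last k)) (q (Fin.last k)) = x := by
    simp only [hq, Fin.snoc_last, max_eq_right_iff]
    exact Fin.cases htx hx (Fin.last k)
  have hzero : min (p 0) (q 0) = t := by
    simp only [hp, Fin.cons_zero, min_eq_left_iff]
    exact Fin.lastCases (motive := fun i => t ≤ q i) (by simpa [hq]) (by simpa [hq]) 0
  have hmax : ∑ i, S (max (p i) (q i)) = ∑ j, S (slotLower r t x τ j) + S x := by
    rw [Fin.sum_univ_castSucc, hlast]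
    rfl
  have hmin : ∑ i, S (min (p i) (q i)) = S t + ∑ j, S (slotUpper r t x τ j) := by
    rw [Fin.sum_univ_succ, hzero]
    rfl
  have hpq : ∑ i, (S (max (p i) (q i)) + S (min (p i) (q i))) = ∑ i, (S (p i) + S (q i)) := by
    refine Finset.sum_congr rfl fun i _ => ?_
    rcases le_total (p i) (q i) with h | h <;> simp [h, add_comm]
  have hsp : ∑ i, S (p i) = S t + ∑ j, S (τ j r) := by simp [hp, Fin.sum_univ_succ]
  have hsq : ∑ i, S (q i) = ∑ j, S (τ j (r + 2)) + S x := by simp [hq, Fin.sum_univ_castSucc]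
  simp only [Finset.sum_add_distrib] at hpq ⊢
  linarith

namespace IsJumpArray

variable {n k r : ℕ} {m : Fin k → Fin n} {t x : ℝ} {τ : Fin k → ℕ → ℝ}

theorem le (hτ : IsJumpArray m t x τ) (j : Fin k) (i : ℕ) : τ j i ≤ x :=
  (hτ.antitone j i.zero_le).trans_eq (hτ.zero j)

theorem ge (hτ : IsJumpArray m t x τ) (j : Fin k) (i : ℕ) : t ≤ τ j i := by
  rw [← hτ.start (lt_of_lt_of_le (m j).isLt (le_max_left n i))]
  exact hτ.antitone j (le_max_right n i)

theorem mem_slot (hτ : IsJumpArray m t x τ) (r : ℕ) (j : Fin k) :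
    τ j (r + 1) ∈ Icc (slotLower r t x τ j) (slotUpper r t x τ j) :=
  ⟨(slotLower_le_iff (hτ.ge _ _)).2
      ⟨hτ.antitone j (by omega), fun i hij => hτ.interlace i j hij r⟩,
    (le_slotUpper_iff (hτ.le _ _)).2
      ⟨hτ.antitone j (by omega), fun i hji => hτ.interlace j i hji (r + 1)⟩⟩

theorem slot_subset (hτ : IsJumpArray m t x τ) (r : ℕ) (j : Fin k) :
    Icc (slotLower r t x τ j) (slotUpper r t x τ j) ⊆ Icc t x :=
  Icc_subset_Icc
    (le_max_of_le_right (by rw [Fin.snoc_castSucc]; exact hτ.ge _ _))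
    (min_le_of_left_le (by rw [Fin.cons_succ]; exact hτ.le _ _))

theorem updateRow (hτ : IsJumpArray m t x τ)
    (hm : ∀ j, (m j : ℕ) = r → ∃ i : Fin k, (j : ℕ) + 1 = i ∧ (m i : ℕ) = r + 1)
    {z : Fin k → ℝ} (hz : ∀ j, z j ∈ Icc (slotLower r t x τ j) (slotUpper r t x τ j)) :
    IsJumpArray m t x (updateRow (r + 1) τ z) := by
  have hzI := fun j => hτ.slot_subset r j (hz j)
  have hlow := fun j => (slotLower_le_iff (hzI j).1).1 (hz j).1
  have hupp := fun j => (le_slotUpper_iff (hzI j).2).1 (hz j).2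
  refine ⟨fun j => ?_, fun j => antitone_nat_of_succ_le fun i => ?_, fun j i hi => ?_,
    fun i j hij s => ?_⟩
  · simpa [RSKLine.updateRow] using hτ.zero j
  · rcases eq_or_ne i r with rfl | hir
    · simpa [RSKLine.updateRow] using (hupp j).1
    · rcases eq_or_ne i (r + 1) with rfl | hir'
      · simpa [RSKLine.updateRow] using (hlow j).1
      · simpa [RSKLine.updateRow, hir, hir'] using hτ.antitone j i.le_succ
  · rcases eq_or_ne i (r + 1) with rfl | hir
    · rw [RSKLine.updateRow, Function.update_self]
      refine (hzI j).1.antisymm' ?_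
      rcases (Nat.lt_succ_iff.1 hi).eq_or_lt with hmj | hmj
      · obtain ⟨j', hj', hmj'⟩ := hm j hmj
        exact ((hupp j).2 j' hj').trans_eq (hτ.start (by omega))
      · exact (hupp j).1.trans_eq (hτ.start hmj)
    · simpa [RSKLine.updateRow, hir] using hτ.start hi
  · rcases eq_or_ne s r with rfl | hsr
    · simpa [RSKLine.updateRow] using (hlow j).2 i hij
    · rcases eq_or_ne s (r + 1) with rfl | hsr'
      · simpa [RSKLine.updateRow] using (hupp i).2 j hij
      · simpa [RSKLine.updateRow, hsr, hsr'] using hτ.interlace i j hij s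

end IsJumpArray

/-! ### Moving mass between adjacent lines -/

/-- Add `S` to line `a` and subtract it from line `b`. -/
def transfer {n : ℕ} (a b : Fin n) (S : ℝ → ℝ) (f : Env n) : Env n :=
  f + Pi.single a S - Pi.single b S

section Transfer

variable {n k : ℕ} {a b : Fin n} {f : Env n}

theorem transfer_apply_left (hne : a ≠ b) (S : ℝ → ℝ) (f : Env n) :
    transfer a b S f a = f a + S := by
  simp [transfer, hne]

theorem transfer_apply_right (hne : a ≠ b) (S : ℝ → ℝ) (f : Env n) :
    transfer a b S f b = f b - S := by
  simp [transfer, hne.symm]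

theorem transfer_apply_of_ne {i : Fin n} (hia : i ≠ a) (hib : i ≠ b) (S : ℝ → ℝ) (f : Env n) :
    transfer a b S f i = f i := by
  simp [transfer, hia, hib]

theorem pathWeight_single (a : Fin n) (S : ℝ → ℝ) (c : ℕ → ℝ) :
    pathWeight (Pi.single a S) c = S (c a) - S (c (a + 1)) := by
  rw [pathWeight, Finset.sum_eq_single_of_mem a (Finset.mem_univ a)]
  · simp
  · intro i _ hi
    simp [Pi.single_eq_of_ne hi]

theorem pathWeight_transfer (hab : (a : ℕ) + 1 = b) (S : ℝ → ℝ) (c : ℕ → ℝ) :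
    pathWeight (transfer a b S f) c =
      pathWeight f c + (S (c a) + S (c (a + 2)) - 2 * S (c (a + 1))) := by
  have hadd : pathWeight (transfer a b S f) c =
      pathWeight f c + pathWeight (Pi.single a S) c - pathWeight (Pi.single b S) c := by
    simp only [pathWeight, transfer, ← Finset.sum_add_distrib, ← Finset.sum_sub_distrib,
      Pi.add_apply, Pi.sub_apply]
    exact Finset.sum_congr rfl fun i _ => by ring
  rw [hadd, pathWeight_single, pathWeight_single, ← hab]
  ring

theorem pathWeight_update (hab : (a : ℕ) + 1 = b) (c : ℕ → ℝ) (z : ℝ) :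
    pathWeight f (Function.update c (a + 1) z) =
      pathWeight f c + ((f b z - f a z) - (f b (c (a + 1)) - f a (c (a + 1)))) := by
  have hne : a ≠ b := by rintro rfl; omega
  simp only [pathWeight, ← Finset.add_sum_erase _ _ (Finset.mem_univ a),
    ← Finset.add_sum_erase _ _ (Finset.mem_erase.2 ⟨hne.symm, Finset.mem_univ b⟩)]
  have hrest : ∀ i ∈ (Finset.univ.erase a).erase b,
      f i (Function.update c (a + 1) z i) - f i (Function.update c (a + 1) z (i + 1)) =
        f i (c i) - f i (c (i + 1)) := by
    intro i hi
    simp only [Finset.mem_erase, ne_eq, Fin.ext_iff] at hi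
    rw [Function.update_of_ne (by omega), Function.update_of_ne (by omega)]
  rw [Finset.sum_congr rfl hrest, ← hab, Function.update_self,
    Function.update_of_ne (a := (a : ℕ)) (by omega),
    Function.update_of_ne (a := (a : ℕ) + 1 + 1) (by omega)]
  ring

theorem weight_updateRow (hab : (a : ℕ) + 1 = b) (τ : Fin k → ℕ → ℝ) (z : Fin k → ℝ) :
    weight f (updateRow (a + 1) τ z) =
      weight f τ + ∑ j, ((f b (z j) - f a (z j)) - (f b (τ j (a + 1)) - f a (τ j (a + 1)))) := by
  simp only [weight, updateRow, pathWeight_update hab, Finset.sum_add_distrib]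

theorem IsJumpArray.weight_transfer {m : Fin k → Fin n} {t x : ℝ} {τ : Fin k → ℕ → ℝ}
    (hτ : IsJumpArray m t x τ) (htx : t ≤ x) (hab : (a : ℕ) + 1 = b) (S : ℝ → ℝ) :
    weight (transfer a b S f) τ = weight f τ +
      ∑ j, (S (slotLower a t x τ j) + S (slotUpper a t x τ j) - 2 * S (τ j (a + 1))) := by
  rw [Finset.sum_sub_distrib, sum_slotLower_add_slotUpper a htx (fun j => hτ.ge j _)
    (fun j => hτ.le j _), ← Finset.sum_sub_distrib]
  simp only [weight, pathWeight_transfer hab, Finset.sum_add_distrib]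

end Transfer

theorem exists_succ_of_mem_range {n k : ℕ} {a b : Fin n} (hab : (a : ℕ) + 1 = b)
    {m : Fin k → Fin n} (hm : StrictMono m) (h : a ∈ range m → b ∈ range m) (j : Fin k)
    (hj : (m j : ℕ) = a) : ∃ i : Fin k, (j : ℕ) + 1 = i ∧ (m i : ℕ) = a + 1 := by
  obtain ⟨i, hi⟩ := h ⟨j, Fin.ext hj⟩
  have hji : j < i := hm.lt_iff_lt.1 (Fin.lt_def.2 (by rw [hj, hi]; omega))
  refine ⟨i, ?_, by rw [hi, hab]⟩
  by_contra hne
  obtain ⟨l, hjl, hli⟩ : ∃ l : Fin k, j < l ∧ l < i :=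
    ⟨⟨j + 1, by omega⟩, Fin.lt_def.2 (by simp), Fin.lt_def.2 (by simp; omega)⟩
  have h1 := Fin.lt_def.1 (hm hjl)
  have h2 := Fin.lt_def.1 (hm hli)
  rw [hi] at h2
  omega

section Cofinality

variable {n k : ℕ} {a b : Fin n} {f : Env n} {S : ℝ → ℝ} {m : Fin k → Fin n} {t x : ℝ}

theorem slotLower_updateRow (r : ℕ) (τ : Fin k → ℕ → ℝ) (z : Fin k → ℝ) :
    slotLower r t x (updateRow (r + 1) τ z) = slotLower r t x τ := by
  funext j
  simp [slotLower, updateRow]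

theorem slotUpper_updateRow (r : ℕ) (τ : Fin k → ℕ → ℝ) (z : Fin k → ℝ) :
    slotUpper r t x (updateRow (r + 1) τ z) = slotUpper r t x τ := by
  funext j
  simp [slotUpper, updateRow]

theorem isCofinalFor_weights_transfer (hab : (a : ℕ) + 1 = b) (hf : ∀ i, Continuous (f i))
    (H : IsRunMax (fun z => f b z - f a z) S) (hm : StrictMono m)
    (h : a ∈ range m → b ∈ range m) (htx : t ≤ x) :
    IsCofinalFor (weights f m t x) (weights (transfer a b S f) m t x) := by
  rintro _ ⟨τ, hτ, rfl⟩
  choose z hz hle using fun j =>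
    H.exists_le_reflected ((hf b).sub (hf a)) (IsJumpArray.mem_slot hτ a j)
  have hτz := IsJumpArray.updateRow hτ (exists_succ_of_mem_range hab hm h) hz
  refine ⟨_, ⟨_, hτz, rfl⟩, ?_⟩
  rw [hτz.weight_transfer htx hab, weight_updateRow hab, slotLower_updateRow, slotUpper_updateRow,
    add_assoc, ← Finset.sum_add_distrib]
  refine le_add_of_nonneg_right (Finset.sum_nonneg fun j _ => ?_)
  simp only [updateRow, Function.update_self]
  linarith [hle j]

theorem isCofinalFor_weights_of_transfer (hab : (a : ℕ) + 1 = b)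
    (H : IsRunMax (fun z => f b z - f a z) S) (hm : StrictMono m)
    (h : a ∈ range m → b ∈ range m) (htx : t ≤ x) :
    IsCofinalFor (weights (transfer a b S f) m t x) (weights f m t x) := by
  rintro _ ⟨τ, hτ, rfl⟩
  choose z hz hle using fun j => H.exists_reflected_le (IsJumpArray.mem_slot hτ a j)
  refine ⟨_, ⟨_, IsJumpArray.updateRow hτ (exists_succ_of_mem_range hab hm h) hz, rfl⟩, ?_⟩
  rw [IsJumpArray.weight_transfer hτ htx hab, weight_updateRow hab]
  gcongr weight f τ + ∑ j, ?_ with j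
  linarith [hle j]

theorem IsJumpArray.swap_comp (hab : (a : ℕ) + 1 = b) (ha : a ∉ range m) {τ : Fin k → ℕ → ℝ}
    (hτ : IsJumpArray m t x τ) (hb : ∀ j, m j = b → τ j (a + 1) = t) :
    IsJumpArray (Equiv.swap a b ∘ m) t x τ := by
  refine ⟨hτ.zero, hτ.antitone, fun j i hi => ?_, hτ.interlace⟩
  have hja : m j ≠ a := fun hj => ha ⟨j, hj⟩
  rcases eq_or_ne (m j) b with hjb | hjb
  · rw [Function.comp_apply, hjb, Equiv.swap_apply_right] at hi
    rcases (Nat.succ_le_of_lt hi).eq_or_lt with rfl | hlt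
    · exact hb j hjb
    · exact hτ.start (by omega)
  · rw [Function.comp_apply, Equiv.swap_apply_of_ne_of_ne hja hjb] at hi
    exact hτ.start hi

theorem IsJumpArray.of_swap_comp (hab : (a : ℕ) + 1 = b) (ha : a ∉ range m)
    {τ : Fin k → ℕ → ℝ} (hτ : IsJumpArray (Equiv.swap a b ∘ m) t x τ) : IsJumpArray m t x τ := by
  refine ⟨hτ.zero, hτ.antitone, fun j i hi => hτ.start (lt_of_le_of_lt ?_ hi), hτ.interlace⟩
  rw [Function.comp_apply, Equiv.swap_apply_def, if_neg fun hj => ha ⟨j, hj⟩]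
  split_ifs with hjb
  · rw [hjb]
    omega
  · exact le_rfl

/-- At a record time `t` of `f b - f a`, a path starting on line `b` of the transferred environment
does not lose by jumping to line `a` immediately. -/
theorem isCofinalFor_weights_swap_comp (hab : (a : ℕ) + 1 = b)
    (H : IsRunMax (fun z => f b z - f a z) S) (ht : f b t - f a t = S t) (hm : StrictMono m)
    (ha : a ∉ range m) :
    IsCofinalFor (weights (transfer a b S f) m t x)
      (weights (transfer a b S f) (Equiv.swap a b ∘ m) t x) := by
  have hne : a ≠ b := by rintro rfl; omega
  rintro _ ⟨τ, hτ, rfl⟩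
  set z : Fin k → ℝ := fun j => if m j = b then t else τ j (a + 1) with hz
  have hz_mem : ∀ j, z j ∈ Icc (slotLower a t x τ j) (slotUpper a t x τ j) := by
    intro j
    have hmem := IsJumpArray.mem_slot hτ a j
    rw [hz]
    dsimp only
    split_ifs with hj
    · have htj : t ≤ τ j (a + 1) := IsJumpArray.ge hτ _ _
      refine ⟨(slotLower_le_iff le_rfl).2 ⟨(hτ.start ?_).le, fun i hij => (hτ.start ?_).le⟩,
        htj.trans hmem.2⟩
      · rw [hj]
        omega
      · have hia : m i ≠ a := fun h => ha ⟨i, h⟩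
        have hib : m i < b := hj ▸ hm (Fin.lt_def.2 (by omega))
        omega
    · exact hmem
  have hτz := IsJumpArray.updateRow hτ
    (exists_succ_of_mem_range hab hm fun h => absurd h ha) hz_mem
  refine ⟨_, ⟨_, hτz.swap_comp hab ha fun j hj => by simp [updateRow, hz, hj], rfl⟩, ?_⟩
  rw [weight_updateRow hab]
  refine le_add_of_nonneg_right (Finset.sum_nonneg fun j _ => ?_)
  by_cases hj : m j = b
  · have htj : t ≤ τ j (a + 1) := IsJumpArray.ge hτ _ _
    have hSS : S t ≤ S (τ j (a + 1)) := H.mono htj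
    have hS : f b (τ j (a + 1)) - f a (τ j (a + 1)) ≤ S (τ j (a + 1)) := H.le le_rfl
    have hzj : z j = t := if_pos hj
    rw [hzj, transfer_apply_left hne, transfer_apply_right hne]
    simp only [Pi.add_apply, Pi.sub_apply]
    linarith
  · simp [hz, hj]

theorem weights_swap_comp_subset (hab : (a : ℕ) + 1 = b) (ha : a ∉ range m) :
    weights f (Equiv.swap a b ∘ m) t x ⊆ weights f m t x :=
  image_mono fun _ hτ => IsJumpArray.of_swap_comp hab ha hτ

end Cofinality

theorem csSup_eq_csSup_of_isCofinalFor {α : Type*} [ConditionallyCompleteLattice α] {A B : Set α}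
    (hA : A.Nonempty) (hb : BddAbove A) (hAB : IsCofinalFor A B) (hBA : IsCofinalFor B A) :
    sSup A = sSup B := by
  have hub : upperBounds A = upperBounds B :=
    (upperBounds_mono_of_isCofinalFor hBA).antisymm (upperBounds_mono_of_isCofinalFor hAB)
  obtain ⟨y, hy⟩ := hA
  obtain ⟨z, hz, -⟩ := hAB hy
  exact (((isLUB_congr hub).1 (isLUB_csSup ⟨y, hy⟩ hb)).csSup_eq ⟨z, hz⟩).symm

section StartingTime

variable {n k : ℕ} {f : Env n} {m : Fin k → Fin n} {t t' x : ℝ} {τ : Fin k → ℕ → ℝ}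

theorem IsJumpArray.const (m : Fin k → Fin n) (x : ℝ) : IsJumpArray m x x fun _ _ => x :=
  ⟨fun _ => rfl, fun _ => antitone_const, fun _ _ _ => rfl, fun _ _ _ _ => le_rfl⟩

/-- Let the paths start at time `t'` instead of `t`, staying on the lines `m` in between. -/
def extendStart (m : Fin k → Fin n) (t' : ℝ) (τ : Fin k → ℕ → ℝ) : Fin k → ℕ → ℝ :=
  fun j i => if i ≤ m j then τ j i else t'

theorem IsJumpArray.extendStart (hm : StrictMono m) (htt' : t' ≤ t) (hτ : IsJumpArray m t x τ) :
    IsJumpArray m t' x (extendStart m t' τ) := by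
  refine ⟨fun j => ?_, fun j i i' hii' => ?_, fun j i hi => if_neg hi.not_ge,
    fun i j hij r => ?_⟩
  · simpa [RSKLine.extendStart] using hτ.zero j
  · by_cases hi' : i' ≤ m j
    · simpa [RSKLine.extendStart, hi', hii'.trans hi'] using hτ.antitone j hii'
    · by_cases hi : i ≤ m j
      · simpa [RSKLine.extendStart, hi, hi'] using htt'.trans (hτ.ge j i)
      · simp [RSKLine.extendStart, hi, hi']
  · have hmij : (m i : ℕ) < m j := hm (Fin.lt_def.2 (by omega))
    by_cases hr : r ≤ m i
    · have hrj : r + 1 ≤ m j := by omega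
      simpa [RSKLine.extendStart, hr, hrj] using hτ.interlace i j hij r
    · by_cases hrj : r + 1 ≤ m j
      · simpa [RSKLine.extendStart, hr, hrj] using htt'.trans (hτ.ge j _)
      · simp [RSKLine.extendStart, hr, hrj]

theorem pathWeight_extendStart (hτ : IsJumpArray m t x τ) (j : Fin k) :
    pathWeight f (extendStart m t' τ j) = pathWeight f (τ j) + (f (m j) t - f (m j) t') := by
  rw [← sub_eq_iff_eq_add', pathWeight, pathWeight, ← Finset.sum_sub_distrib,
    Finset.sum_eq_single_of_mem (m j) (Finset.mem_univ _)]
  · simp only [extendStart, le_refl, if_true, Nat.not_succ_le_self, if_false,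
      hτ.start (Nat.lt_succ_self _)]
    ring
  · intro i _ hi
    have hne : (i : ℕ) ≠ m j := fun h => hi (Fin.ext h)
    rcases hne.lt_or_gt with hlt | hlt
    · simp [extendStart, hlt.le, Nat.succ_le_of_lt hlt]
    · have h1 : ¬(i : ℕ) ≤ m j := by omega
      have h2 : ¬(i : ℕ) + 1 ≤ m j := by omega
      simp [extendStart, h1, h2, hτ.start hlt, hτ.start (hlt.trans i.val.lt_succ_self)]

theorem weights_nonempty (hm : StrictMono m) (htx : t ≤ x) : (weights f m t x).Nonempty :=
  ⟨_, _, (IsJumpArray.const m x).extendStart hm htx, rfl⟩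

theorem weights_bddAbove (hf : ∀ i, Continuous (f i)) (m : Fin k → Fin n) (t x : ℝ) :
    BddAbove (weights f m t x) := by
  choose B hB using fun i =>
    (isCompact_Icc (a := t) (b := x)).exists_bound_of_continuousOn (hf i).continuousOn
  refine ⟨∑ _j : Fin k, ∑ i, (B i + B i), ?_⟩
  rintro _ ⟨τ, hτ, rfl⟩
  have hmem : ∀ j i, τ j i ∈ Icc t x := fun j i => ⟨IsJumpArray.ge hτ j i, IsJumpArray.le hτ j i⟩
  refine Finset.sum_le_sum fun j _ => Finset.sum_le_sum fun i _ => ?_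
  have h1 := le_abs_self (f i (τ j i))
  have h2 := neg_abs_le (f i (τ j (i + 1)))
  have h3 := hB i _ (hmem j i)
  have h4 := hB i _ (hmem j (i + 1))
  rw [Real.norm_eq_abs] at h3 h4
  linarith

theorem IsJumpArray.eq_extendStart_const {hk : k ≤ n} (hτ : IsJumpArray (Fin.castLE hk) t x τ) :
    τ = RSKLine.extendStart (Fin.castLE hk) t fun _ _ => x := by
  have hx : ∀ i : ℕ, ∀ j : Fin k, i ≤ j → τ j i = x := by
    intro i
    induction i with
    | zero => exact fun j _ => hτ.zero j
    | succ i ih =>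
      intro j hij
      obtain ⟨j', hj'⟩ : ∃ j' : Fin k, (j' : ℕ) + 1 = j := ⟨⟨j - 1, by omega⟩, by simp; omega⟩
      refine (hτ.le j _).antisymm ?_
      rw [← ih j' (by omega)]
      exact hτ.interlace j' j hj' i
  funext j i
  rw [RSKLine.extendStart, Fin.val_castLE]
  split_ifs with hij
  · exact hx i j hij
  · exact hτ.start (not_le.1 hij)

theorem weights_firstLines (f : Env n) (hk : k ≤ n) (htx : t ≤ x) :
    weights f (Fin.castLE hk) t x =
      {∑ j, (f (Fin.castLE hk j) x - f (Fin.castLE hk j) t)} := by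
  refine (weights_nonempty (Fin.strictMono_castLE hk) htx).subset_singleton_iff.1 ?_
  rintro _ ⟨τ, hτ, rfl⟩
  refine Finset.sum_congr rfl fun j _ => ?_
  rw [IsJumpArray.eq_extendStart_const hτ, pathWeight_extendStart (IsJumpArray.const _ x)]
  simp [pathWeight]

end StartingTime

/-! ### Paths and their jump times -/

/-- The time at which a path on `[t, x]` leaves line `i`; compare `timeLT`. The line index is a
natural number, so that the time at which the path reaches line `i` is the one for `i + 1`. -/
noncomputable def jumpTime {n : ℕ} (π : ℝ → Fin n) (t x : ℝ) (i : ℕ) : ℝ :=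
  sInf (insert x {s | s ∈ Icc t x ∧ (π s : ℕ) < i})

/-- The path that starts on line `a` and reaches line `i` or passes it at time `c (i + 1)`. -/
noncomputable def pathOf {n : ℕ} (c : ℕ → ℝ) (a : Fin n) (s : ℝ) : Fin n :=
  ⟨min a (sInf {i : ℕ | c (i + 1) ≤ s}), (min_le_left _ _).trans_lt a.isLt⟩

section Paths

variable {n k : ℕ} {f : Env n} {π : ℝ → Fin n} {m : Fin k → Fin n} {a : Fin n} {t x s : ℝ}
  {c : ℕ → ℝ} {i : ℕ}

theorem isGLB_jumpTime (π : ℝ → Fin n) (htx : t ≤ x) (i : ℕ) :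
    IsGLB (insert x {s | s ∈ Icc t x ∧ (π s : ℕ) < i}) (jumpTime π t x i) := by
  refine isGLB_csInf ⟨x, Or.inl rfl⟩ ⟨t, ?_⟩
  rintro s (rfl | hs)
  · exact htx
  · exact hs.1.1

theorem jumpTime_le (π : ℝ → Fin n) (htx : t ≤ x) (i : ℕ) : jumpTime π t x i ≤ x :=
  (isGLB_jumpTime π htx i).1 (Or.inl rfl)

theorem jumpTime_le_of_lt (hs : s ∈ Icc t x) (hi : (π s : ℕ) < i) : jumpTime π t x i ≤ s :=
  (isGLB_jumpTime π (hs.1.trans hs.2) i).1 (Or.inr ⟨hs, hi⟩)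

theorem le_jumpTime_iff (htx : t ≤ x) :
    s ≤ jumpTime π t x i ↔ s ≤ x ∧ ∀ r ∈ Icc t x, (π r : ℕ) < i → s ≤ r := by
  simp only [le_isGLB_iff (isGLB_jumpTime π htx i), mem_lowerBounds, forall_mem_insert, mem_ofPred,
    and_imp]

theorem jumpTime_zero (π : ℝ → Fin n) (t x : ℝ) : jumpTime π t x 0 = x := by
  simp [jumpTime]

theorem jumpTime_eq_start (htx : t ≤ x) (hi : (π t : ℕ) < i) : jumpTime π t x i = t :=
  (jumpTime_le_of_lt ⟨le_rfl, htx⟩ hi).antisymm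
    ((le_jumpTime_iff htx).2 ⟨htx, fun _ hs _ => hs.1⟩)

theorem jumpTime_antitone (π : ℝ → Fin n) (htx : t ≤ x) : Antitone (jumpTime π t x) :=
  fun _ _ hij => (le_jumpTime_iff htx).2
    ⟨jumpTime_le π htx _, fun _ hr hri => jumpTime_le_of_lt hr (hri.trans_le hij)⟩

theorem pathLength_eq_pathWeight (htx : t ≤ x) (hπ : π t ≤ a) :
    pathLength f π t a x ⟨0, a.pos⟩ = pathWeight f (jumpTime π t x) := by
  have hLE : ∀ i : Fin n, timeLE π t x i = jumpTime π t x (i + 1) := fun i => by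
    simp only [timeLE, jumpTime, Nat.lt_succ_iff, Fin.le_def]
  simp only [pathLength, pathWeight, hLE]
  refine Finset.sum_subset (Finset.subset_univ _) fun i _ hi => ?_
  have hai : a < i := by
    by_contra! hia
    exact hi (Finset.mem_Icc.2 ⟨Fin.le_def.2 i.val.zero_le, hia⟩)
  have hti : π t < i := hπ.trans_lt hai
  change f i (jumpTime π t x i) - _ = 0
  rw [jumpTime_eq_start htx hti, jumpTime_eq_start htx (Nat.lt_succ_of_lt hti), sub_self]

theorem pathOf_le (c : ℕ → ℝ) (a : Fin n) (s : ℝ) : pathOf c a s ≤ a :=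
  min_le_left (a : ℕ) _

theorem pathOf_lt_succ_iff (hc : Antitone c) (hs : c (a + 1) ≤ s) :
    (pathOf c a s : ℕ) < i + 1 ↔ c (i + 1) ≤ s := by
  have hle : sInf {i : ℕ | c (i + 1) ≤ s} ≤ a := Nat.sInf_le hs
  have hval : (pathOf c a s : ℕ) = sInf {i : ℕ | c (i + 1) ≤ s} := min_eq_right hle
  rw [Nat.lt_succ_iff, hval]
  exact ⟨fun h => (hc (Nat.succ_le_succ h)).trans (Nat.sInf_mem (s := {i | c (i + 1) ≤ s}) ⟨a, hs⟩),
    fun h => Nat.sInf_le h⟩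

theorem pathOf_antitoneOn (hc : Antitone c) : AntitoneOn (pathOf c a) (Ici (c (a + 1))) :=
  fun _ hs _ hs' hss' => Nat.lt_succ_iff.1 ((pathOf_lt_succ_iff hc hs').2
    (((pathOf_lt_succ_iff hc hs).1 (Nat.lt_succ_self _)).trans hss'))

theorem pathOf_rightCont (hc : Antitone c) (hs : c (a + 1) ≤ s) :
    ContinuousWithinAt (pathOf c a) (Ici s) s := by
  refine (continuousWithinAt_const (b := pathOf c a s)).congr_of_eventuallyEq ?_ rfl
  have hle : ∀ s' ∈ Ici s, pathOf c a s' ≤ pathOf c a s := fun s' hs' =>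
    pathOf_antitoneOn hc hs (hs.trans hs') hs'
  rcases hp : (pathOf c a s : ℕ) with _ | p
  · filter_upwards [self_mem_nhdsWithin] with s' hs'
    exact (hle s' hs').antisymm (Fin.le_def.2 (by omega))
  · have hsp : s < c (p + 1) := by
      rw [← not_le, ← pathOf_lt_succ_iff hc hs]
      omega
    filter_upwards [self_mem_nhdsWithin, mem_nhdsWithin_of_mem_nhds (gt_mem_nhds hsp)]
      with s' hs' hs'p
    rw [← not_le, ← pathOf_lt_succ_iff hc (hs.trans hs')] at hs'p
    exact (hle s' hs').antisymm (Fin.le_def.2 (by omega))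

theorem isPath_pathOf (hc : Antitone c) (ht : c (a + 1) = t) (htx : t ≤ x) :
    IsPath (pathOf c a) t a x ⟨0, a.pos⟩ where
  le := htx
  antitone := (pathOf_antitoneOn hc).mono (Icc_subset_Ici_self.trans_eq (by rw [ht]))
  rightCont _ hs := (pathOf_rightCont hc (ht.trans_le hs.1)).mono Icc_subset_Ici_self
  mem s _ := ⟨Fin.le_def.2 (Nat.zero_le _), pathOf_le c a s⟩

theorem jumpTime_pathOf (hc : Antitone c) (h0 : c 0 = x) (ht : ∀ i, t ≤ c i)
    (ha : c (a + 1) = t) : jumpTime (pathOf c a) t x = c := by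
  have hx : ∀ i, c i ≤ x := fun i => (hc i.zero_le).trans_eq h0
  funext i
  cases i with
  | zero => rw [jumpTime_zero, h0]
  | succ i =>
    refine (jumpTime_le_of_lt ⟨ht _, hx _⟩ ?_).antisymm
      ((le_jumpTime_iff ((ht 0).trans_eq h0)).2 ⟨hx _, fun s hs hsi => ?_⟩)
    · exact (pathOf_lt_succ_iff hc (ha.trans_le (ht _))).2 le_rfl
    · exact (pathOf_lt_succ_iff hc (ha.trans_le hs.1)).1 hsi

theorem IsDisjointTuple.isJumpArray {π : Fin k → ℝ → Fin n} (htx : t ≤ x)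
    (hπ : IsDisjointTuple π (fun _ => t) m (fun _ => x) fun j => ⟨0, (m j).pos⟩) :
    IsJumpArray m t x fun j => jumpTime (π j) t x := by
  refine ⟨fun j => jumpTime_zero _ _ _, fun j => jumpTime_antitone _ htx,
    fun j i hi => jumpTime_eq_start htx ?_, fun i j hij r =>
      (le_jumpTime_iff htx).2 ⟨jumpTime_le _ htx _, fun s hs hsr => ?_⟩⟩
  · exact lt_of_le_of_lt ((hπ.isPath j).mem t ⟨le_rfl, htx⟩).2 hi
  · have hlt : ∀ s' ∈ Ioo s x, jumpTime (π i) t x r ≤ s' := fun s' hs' => by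
      have hs'I : s' ∈ Icc t x := ⟨hs.1.trans hs'.1.le, hs'.2.le⟩
      have hs't : s' ∈ Ioo t x := ⟨hs.1.trans_lt hs'.1, hs'.2⟩
      have hjs : π j s' ≤ π j s := (hπ.isPath j).antitone hs hs'I hs'.1.le
      have hij' : π i s' < π j s' := hπ.disjoint i j hij s' ⟨hs't, hs't⟩
      exact jumpTime_le_of_lt hs'I (by omega)
    rcases hs.2.eq_or_lt with rfl | hsx
    · exact jumpTime_le _ htx _
    · exact (isGLB_Ioo hsx).2 hlt

theorem IsJumpArray.isDisjointTuple {τ : Fin k → ℕ → ℝ} (hτ : IsJumpArray m t x τ) (htx : t ≤ x) :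
    IsDisjointTuple (fun j => pathOf (τ j) (m j)) (fun _ => t) m (fun _ => x)
      fun j => ⟨0, (m j).pos⟩ := by
  have hend : ∀ j, τ j (m j + 1) = t := fun j => hτ.start (Nat.lt_succ_self _)
  refine ⟨fun j => isPath_pathOf (hτ.antitone j) (hend j) htx, ?_⟩
  rintro i j hij s ⟨⟨hts, hsx⟩, -⟩
  have hend_le : ∀ j, τ j (m j + 1) ≤ s := fun j => (hend j).trans_le hts.le
  have hle : τ i (pathOf (τ j) (m j) s) ≤ s := (hτ.interlace i j hij _).trans
    ((pathOf_lt_succ_iff (hτ.antitone j) (hend_le j)).1 (Nat.lt_succ_self _))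
  rw [Fin.lt_def]
  rcases hp : (pathOf (τ j) (m j) s : ℕ) with _ | p
  · rw [hp, hτ.zero] at hle
    exact absurd hle hsx.not_ge
  · rw [hp] at hle
    exact (pathOf_lt_succ_iff (hτ.antitone i) (hend_le i)).2 hle

theorem lpp_eq_sSup_weights (f : Env n) (m : Fin k → Fin n) (htx : t ≤ x) :
    lpp f (fun _ => t) m (fun _ => x) (fun j => ⟨0, (m j).pos⟩) = sSup (weights f m t x) := by
  refine congrArg sSup (Subset.antisymm ?_ ?_)
  · rintro _ ⟨π, hπ, rfl⟩
    exact ⟨_, hπ.isJumpArray htx, Finset.sum_congr rfl fun j _ =>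
      (pathLength_eq_pathWeight htx ((hπ.isPath j).mem t ⟨le_rfl, htx⟩).2).symm⟩
  · rintro _ ⟨τ, hτ, rfl⟩
    refine ⟨_, IsJumpArray.isDisjointTuple hτ htx, Finset.sum_congr rfl fun j _ => ?_⟩
    rw [pathLength_eq_pathWeight htx (pathOf_le _ _ _), jumpTime_pathOf (hτ.antitone j) (hτ.zero j)
      (IsJumpArray.ge hτ j) (hτ.start (Nat.lt_succ_self _))]

end Paths

/-! ### Pitman operators and orbits -/

section Pitman

variable {n : ℕ} {e f g : Env n} {lam : Fin n → ℝ} {a b : Fin n} {S : ℝ → ℝ}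

theorem HasSlope.asympSlope_eq (h : HasSlope f lam) : asympSlope f = lam :=
  funext fun i => (h i).1.limUnder_eq

theorem hasSlope_asympSlope (hf : f ∈ C n) : HasSlope f (asympSlope f) := by
  obtain ⟨-, lam, h⟩ := hf
  rwa [h.asympSlope_eq]

theorem HasSlope.tendsto_sub_div_atTop (h : HasSlope f lam) (a b : Fin n) :
    Tendsto (fun x => (f b x - f a x) / x) atTop (𝓝 (lam b - lam a)) := by
  simpa only [sub_div] using (h b).1.sub (h a).1

theorem HasSlope.tendsto_sub_div_atBot (h : HasSlope f lam) (a b : Fin n) :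
    Tendsto (fun x => (f b x - f a x) / x) atBot (𝓝 (lam b - lam a)) := by
  simpa only [sub_div] using (h b).2.sub (h a).2

theorem HasSlope.reflect (h : HasSlope f lam) : HasSlope (R f) fun i => -lam i := by
  have hR : ∀ i x, R f i x / x = -(f i (-x) / (-x)) := fun i x => by
    rw [div_neg, neg_neg, R]
  intro i
  simp only [hR]
  exact ⟨((h i).2.comp tendsto_neg_atTop_atBot).neg, ((h i).1.comp tendsto_neg_atBot_atTop).neg⟩

theorem R_R (f : Env n) : R (R f) = f := by
  funext i x
  rw [R, R, neg_neg]

theorem R_mem_C (hf : f ∈ C n) : R f ∈ C n :=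
  ⟨fun i => (hf.1 i).comp continuous_neg, _, (hasSlope_asympSlope hf).reflect⟩

theorem asympSlope_R (hf : f ∈ C n) : asympSlope (R f) = fun i => -asympSlope f i :=
  (hasSlope_asympSlope hf).reflect.asympSlope_eq

theorem R_mem_CGE (hf : f ∈ CLE n) : R f ∈ CGE n :=
  ⟨R_mem_C hf.1, by rw [asympSlope_R hf.1]; exact hf.2.neg⟩

theorem R_mem_CLE (hf : f ∈ CGE n) : R f ∈ CLE n :=
  ⟨R_mem_C hf.1, by rw [asympSlope_R hf.1]; exact hf.2.neg⟩

theorem R_mem_CLT (hf : f ∈ CGT n) : R f ∈ CLT n :=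
  ⟨R_mem_C hf.1, by rw [asympSlope_R hf.1]; exact hf.2.neg⟩

theorem continuous_transfer (hf : ∀ i, Continuous (f i)) (hS : Continuous S) (i : Fin n) :
    Continuous (transfer a b S f i) := by
  have hsingle : ∀ c : Fin n, Continuous (Pi.single (M := fun _ => ℝ → ℝ) c S i) := by
    intro c
    rcases eq_or_ne i c with rfl | hic
    · simpa using hS
    · simpa [hic] using continuous_zero
  exact ((hf i).add (hsingle a)).sub (hsingle b)

theorem HasSlope.transfer (h : HasSlope f lam) (hne : a ≠ b)
    (hT : Tendsto (fun x => S x / x) atTop (𝓝 (lam b - lam a)))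
    (hB : Tendsto (fun x => S x / x) atBot (𝓝 (lam b - lam a))) :
    HasSlope (transfer a b S f) (lam ∘ Equiv.swap a b) := by
  intro i
  rcases eq_or_ne i a with rfl | hia
  · simp only [transfer_apply_left hne, Function.comp_apply, Equiv.swap_apply_left, Pi.add_apply,
      add_div]
    exact ⟨by simpa using (h i).1.add hT, by simpa using (h i).2.add hB⟩
  · rcases eq_or_ne i b with rfl | hib
    · simp only [transfer_apply_right hne, Function.comp_apply, Equiv.swap_apply_right,
        Pi.sub_apply, sub_div]
      exact ⟨by simpa using (h i).1.sub hT, by simpa using (h i).2.sub hB⟩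
    · simpa [transfer_apply_of_ne hia hib, Equiv.swap_apply_of_ne_of_ne hia hib] using h i

theorem exists_isRunMax_sub (hf : f ∈ C n) (hlt : asympSlope f a < asympSlope f b) :
    ∃ S, IsRunMax (fun z => f b z - f a z) S :=
  IsRunMax.exists_of_tendsto_atBot ((hf.1 b).sub (hf.1 a)) <|
    tendsto_atBot_of_tendsto_div (sub_pos.2 hlt) <|
      (hasSlope_asympSlope hf).tendsto_sub_div_atBot a b

theorem pitman_of_le (h : asympSlope f b ≤ asympSlope f a) : pitman a b f = f :=
  if_neg h.not_gt

theorem pitman_eq_transfer (hlt : asympSlope f a < asympSlope f b)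
    (H : IsRunMax (fun z => f b z - f a z) S) : pitman a b f = transfer a b S f := by
  have hne : a ≠ b := by rintro rfl; exact hlt.false
  funext i x
  rw [pitman, if_pos hlt, H.iSup_eq x]
  split_ifs with hia hib
  · rw [hia, transfer_apply_left hne, Pi.add_apply]
  · rw [hib, transfer_apply_right hne, Pi.sub_apply]
  · rw [transfer_apply_of_ne hia hib]

theorem hasSlope_pitman (hf : f ∈ C n) (hlt : asympSlope f a < asympSlope f b) :
    HasSlope (pitman a b f) (asympSlope f ∘ Equiv.swap a b) := by
  obtain ⟨S, H⟩ := exists_isRunMax_sub hf hlt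
  have hs := hasSlope_asympSlope hf
  rw [pitman_eq_transfer hlt H]
  exact hs.transfer (by rintro rfl; exact hlt.false)
    (H.tendsto_div_atTop (sub_pos.2 hlt) (hs.tendsto_sub_div_atTop a b))
    (H.tendsto_div_atBot (sub_pos.2 hlt) (hs.tendsto_sub_div_atBot a b))

theorem asympSlope_pitman (hf : f ∈ C n) (hlt : asympSlope f a < asympSlope f b) :
    asympSlope (pitman a b f) = asympSlope f ∘ Equiv.swap a b :=
  (hasSlope_pitman hf hlt).asympSlope_eq

theorem pitman_mem_C (hf : f ∈ C n) : pitman a b f ∈ C n := by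
  rcases lt_or_ge (asympSlope f a) (asympSlope f b) with hlt | hle
  · obtain ⟨S, H⟩ := exists_isRunMax_sub hf hlt
    refine ⟨?_, _, hasSlope_pitman hf hlt⟩
    rw [pitman_eq_transfer hlt H]
    exact continuous_transfer hf.1 (H.continuous ((hf.1 b).sub (hf.1 a)))
  · rwa [pitman_of_le hle]

theorem coPitman_pitman (hf : f ∈ C n) (hlt : asympSlope f a < asympSlope f b) :
    coPitman a b (pitman a b f) = f := by
  obtain ⟨S, H⟩ := exists_isRunMax_sub hf hlt
  have hne : a ≠ b := by rintro rfl; exact hlt.false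
  have hlt' : asympSlope (R (pitman a b f)) a < asympSlope (R (pitman a b f)) b := by
    simpa [asympSlope_R (pitman_mem_C hf), asympSlope_pitman hf hlt] using hlt
  have htop : Tendsto (fun z => f b z - f a z) atTop atTop :=
    tendsto_atTop_of_tendsto_div (sub_pos.2 hlt) <|
      (hasSlope_asympSlope hf).tendsto_sub_div_atTop a b
  rw [pitman_eq_transfer hlt H] at hlt' ⊢
  have H' : IsRunMax (fun z => R (transfer a b S f) b z - R (transfer a b S f) a z)
      (fun x => -S (-x)) := by
    refine (congrArg (IsRunMax · _) (funext fun z => ?_)).mpr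
      (H.reflected ((hf.1 b).sub (hf.1 a)) htop)
    simp only [R, transfer_apply_left hne, transfer_apply_right hne, Pi.add_apply, Pi.sub_apply]
    ring
  rw [coPitman, pitman_eq_transfer hlt' H']
  funext i x
  rcases eq_or_ne i a with rfl | hia
  · simp [R, transfer_apply_left hne]
  · rcases eq_or_ne i b with rfl | hib
    · simp [R, transfer_apply_right hne]
    · simp [R, transfer_apply_of_ne hia hib]

theorem coPitman_R (f : Env n) : coPitman a b (R f) = R (pitman a b f) := by
  rw [coPitman, R_R]

theorem pitman_R (f : Env n) : pitman a b (R f) = R (coPitman a b f) := by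
  rw [coPitman, R_R]

theorem pitman_coPitman (hf : f ∈ C n) (hlt : asympSlope (R f) a < asympSlope (R f) b) :
    pitman a b (coPitman a b f) = f := by
  rw [coPitman, pitman_R, coPitman_pitman (R_mem_C hf) hlt, R_R]

theorem asympSlope_coPitman_lt (hf : f ∈ C n) (hlt : asympSlope (R f) a < asympSlope (R f) b) :
    asympSlope (coPitman a b f) a < asympSlope (coPitman a b f) b := by
  have hRf := R_mem_C hf
  simpa [coPitman, asympSlope_R (pitman_mem_C hRf), asympSlope_pitman hRf hlt] using hlt

theorem self_mem_orbit (f : Env n) : f ∈ orbit f := ⟨1, one_mem _, rfl⟩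

theorem orbit_trans (hfg : g ∈ orbit f) (hge : e ∈ orbit g) : e ∈ orbit f := by
  obtain ⟨P, hP, rfl⟩ := hfg
  obtain ⟨Q, hQ, rfl⟩ := hge
  exact ⟨Q * P, mul_mem hQ hP, rfl⟩

theorem pitman_mem_orbit (hab : (a : ℕ) + 1 = b) (f : Env n) : pitman a b f ∈ orbit f :=
  ⟨_, Submonoid.subset_closure ⟨a, b, hab, Or.inl rfl⟩, rfl⟩

theorem coPitman_mem_orbit (hab : (a : ℕ) + 1 = b) (f : Env n) : coPitman a b f ∈ orbit f :=
  ⟨_, Submonoid.subset_closure ⟨a, b, hab, Or.inr rfl⟩, rfl⟩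

theorem orbit_induction {p : Env n → Prop} (hf : p f)
    (hpitman : ∀ g (a b : Fin n), (a : ℕ) + 1 = b → p g → p (pitman a b g))
    (hcoPitman : ∀ g (a b : Fin n), (a : ℕ) + 1 = b → p g → p (coPitman a b g))
    (hg : g ∈ orbit f) : p g := by
  obtain ⟨P, hP, rfl⟩ := hg
  induction hP using Submonoid.closure_induction_left with
  | one => exact hf
  | mul_left Q hQ P _ ih =>
    obtain ⟨a, b, hab, rfl | rfl⟩ := hQ
    · exact hpitman _ a b hab ih
    · exact hcoPitman _ a b hab ih

theorem mem_C_of_mem_orbit (hf : f ∈ C n) (hg : g ∈ orbit f) : g ∈ C n :=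
  orbit_induction hf (fun _ _ _ _ => pitman_mem_C)
    (fun _ _ _ _ hg => R_mem_C (pitman_mem_C (R_mem_C hg))) hg

theorem R_mem_orbit (hg : g ∈ orbit f) : R g ∈ orbit (R f) := by
  refine orbit_induction (p := fun g => R g ∈ orbit (R f)) (self_mem_orbit _) ?_ ?_ hg
  · intro g a b hab h
    rw [← coPitman_R]
    exact orbit_trans h (coPitman_mem_orbit hab _)
  · intro g a b hab h
    rw [← pitman_R]
    exact orbit_trans h (pitman_mem_orbit hab _)

/-- A nontrivial co-Pitman step undoes a nontrivial Pitman step, so an invariant of the orbits needs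
to be checked only along the latter. -/
theorem iff_of_mem_orbit {p : Env n → Prop} (hf : f ∈ C n)
    (hp : ∀ g ∈ C n, ∀ a b : Fin n, (a : ℕ) + 1 = b → asympSlope g a < asympSlope g b →
      (p g ↔ p (pitman a b g))) (hg : g ∈ orbit f) : p f ↔ p g := by
  refine (orbit_induction (p := fun g => g ∈ C n ∧ (p f ↔ p g)) ⟨hf, Iff.rfl⟩ ?_ ?_ hg).2
  · rintro g a b hab ⟨hg, h⟩
    refine ⟨pitman_mem_C hg, h.trans ?_⟩
    rcases lt_or_ge (asympSlope g a) (asympSlope g b) with hlt | hle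
    · exact hp g hg a b hab hlt
    · rw [pitman_of_le hle]
  · rintro g a b hab ⟨hg, h⟩
    have hcg : coPitman a b g ∈ C n := R_mem_C (pitman_mem_C (R_mem_C hg))
    refine ⟨hcg, h.trans ?_⟩
    rcases lt_or_ge (asympSlope (R g) a) (asympSlope (R g) b) with hlt | hle
    · rw [hp _ hcg a b hab (asympSlope_coPitman_lt hg hlt), pitman_coPitman hg hlt]
    · rw [coPitman, pitman_of_le hle, R_R]

theorem orbit_symm (hf : f ∈ C n) (hg : g ∈ orbit f) : f ∈ orbit g := by
  refine (iff_of_mem_orbit (p := fun g => f ∈ orbit g) hf ?_ hg).1 (self_mem_orbit f)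
  intro g hg a b hab hlt
  have hco := coPitman_mem_orbit hab (pitman a b g)
  rw [coPitman_pitman hg hlt] at hco
  exact ⟨orbit_trans hco, orbit_trans (pitman_mem_orbit hab g)⟩

theorem exists_perm_of_mem_orbit (hf : f ∈ C n) (hg : g ∈ orbit f) :
    ∃ σ : Equiv.Perm (Fin n), asympSlope g = asympSlope f ∘ σ := by
  refine (iff_of_mem_orbit
    (p := fun g => ∃ σ : Equiv.Perm (Fin n), asympSlope g = asympSlope f ∘ σ) hf ?_ hg).1 ⟨1, rfl⟩
  intro g hg a b _ hlt
  rw [asympSlope_pitman hg hlt]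
  refine (Equiv.mulRight (Equiv.swap a b)).exists_congr fun σ => ?_
  rw [Equiv.coe_mulRight, Equiv.Perm.coe_mul, ← Function.comp_assoc,
    (Equiv.swap a b).surjective.injective_comp_right.eq_iff]

theorem antitone_of_adjacent (h : ∀ a b : Fin n, (a : ℕ) + 1 = b → lam b ≤ lam a) :
    Antitone lam := by
  cases n with
  | zero => exact fun i => i.elim0
  | succ n => exact Fin.antitone_iff_succ_le.2 fun i => h _ _ rfl

/-- A nontrivial Pitman operator increases the slope vector lexicographically, so an element of the
orbit whose slope vector is maximal is fixed by all of them. -/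
theorem exists_mem_orbit_mem_CGE (hf : f ∈ C n) : ∃ g ∈ orbit f, g ∈ CGE n := by
  have hfin : ((fun g => toLex (asympSlope g)) '' orbit f).Finite := by
    refine (finite_range fun σ : Equiv.Perm (Fin n) => toLex (asympSlope f ∘ σ)).subset ?_
    rintro _ ⟨g, hg, rfl⟩
    obtain ⟨σ, hσ⟩ := exists_perm_of_mem_orbit hf hg
    exact ⟨σ, congrArg toLex hσ.symm⟩
  obtain ⟨g, hg, hmax⟩ := hfin.exists_maximalFor' _ _ ⟨f, self_mem_orbit f⟩
  have hgC := mem_C_of_mem_orbit hf hg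
  refine ⟨g, hg, hgC, antitone_of_adjacent fun a b hab => not_lt.1 fun hlt => ?_⟩
  have hlex : toLex (asympSlope g) < toLex (asympSlope (pitman a b g)) := by
    have hdesc := Pi.lex_desc (f := asympSlope g ∘ Equiv.swap a b) (i := a) (j := b)
      (Fin.le_def.2 (by omega)) (by simpa using hlt)
    rwa [Function.comp_assoc, ← Equiv.Perm.coe_mul, Equiv.swap_mul_self, Equiv.Perm.coe_one,
      Function.comp_id, ← asympSlope_pitman hgC hlt] at hdesc
  exact hlex.not_ge (hmax (orbit_trans hg (pitman_mem_orbit hab g)) hlex.le)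

end Pitman

/-! ### Last passage values from `-∞` -/

theorem tendsto_atBot_of_antitoneOn_of_frequently_eq {α β : Type*} [LinearOrder α] [LinearOrder β]
    [TopologicalSpace β] [OrderTopology β] {G G' : α → β} {x : α} {v : β}
    (hG' : AntitoneOn G' (Iic x)) (heq : ∃ᶠ t in atBot, G t = G' t) (hG : Tendsto G atBot (𝓝 v)) :
    Tendsto G' atBot (𝓝 v) := by
  rw [tendsto_order] at hG ⊢
  constructor
  · intro c hc
    obtain ⟨t, ht, hct, htx⟩ :=
      (heq.and_eventually ((hG.1 c hc).and (eventually_le_atBot x))).exists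
    filter_upwards [eventually_le_atBot t] with s hs
    exact (ht ▸ hct).trans_le (hG' (hs.trans htx) htx hs)
  · intro c hc
    filter_upwards [eventually_le_atBot x, eventually_forall_le_atBot.2 (hG.2 c hc)] with s hsx hlt
    obtain ⟨t, ht, hts⟩ := (heq.and_eventually (eventually_le_atBot s)).exists
    exact (hG' (hts.trans hsx) hsx hts).trans_lt (ht ▸ hlt t hts)

theorem swap_lt_swap {n : ℕ} {a b p q : Fin n} (hab : (a : ℕ) + 1 = b) (hpq : p < q)
    (h : p = a → q ≠ b) : Equiv.swap a b p < Equiv.swap a b q := by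
  simp only [Equiv.swap_apply_def, Fin.lt_def, Fin.ext_iff, ne_eq] at *
  split_ifs <;> omega

theorem sum_comp_eq_of_range_eq {ι κ M : Type*} [Fintype ι] [AddCommMonoid M] {u v : ι → κ}
    (hu : Function.Injective u) (hv : Function.Injective v) (h : range u = range v) (F : κ → M) :
    ∑ i, F (u i) = ∑ i, F (v i) := by
  rw [← finsum_eq_sum_of_fintype, ← finsum_eq_sum_of_fintype, ← finsum_mem_range hu,
    ← finsum_mem_range hv, h]

section FromBot

variable {n k : ℕ} {f : Env n} {a b : Fin n} {S : ℝ → ℝ} {m m' : Fin k → Fin n} {t x v : ℝ}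

theorem lppFrom_eq (f : Env n) (m : Fin k → Fin n) (htx : t ≤ x) :
    lppFrom f m x t = sSup (weights f m t x) + ∑ j, f (m j) t := by
  rw [lppFrom, lpp_eq_sSup_weights f m htx]

theorem lppFrom_antitoneOn (hf : ∀ i, Continuous (f i)) (hm : StrictMono m) (x : ℝ) :
    AntitoneOn (lppFrom f m x) (Iic x) := by
  intro t' ht' t ht htt'
  rw [lppFrom_eq f m ht, lppFrom_eq f m ht', ← le_sub_iff_add_le, add_sub_assoc,
    ← Finset.sum_sub_distrib]
  refine csSup_le (weights_nonempty hm ht) ?_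
  rintro _ ⟨τ, hτ, rfl⟩
  have h := le_csSup (weights_bddAbove hf m t' x) ⟨_, hτ.extendStart hm htt', rfl⟩
  simp only [weight, pathWeight_extendStart hτ, Finset.sum_add_distrib,
    Finset.sum_sub_distrib] at h ⊢
  linarith

theorem sSup_weights_transfer (hab : (a : ℕ) + 1 = b) (hf : ∀ i, Continuous (f i))
    (H : IsRunMax (fun z => f b z - f a z) S) (hm : StrictMono m)
    (h : a ∈ range m → b ∈ range m) (htx : t ≤ x) :
    sSup (weights (transfer a b S f) m t x) = sSup (weights f m t x) :=
  (csSup_eq_csSup_of_isCofinalFor (weights_nonempty hm htx) (weights_bddAbove hf m t x)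
    (isCofinalFor_weights_transfer hab hf H hm h htx)
    (isCofinalFor_weights_of_transfer hab H hm h htx)).symm

theorem sSup_weights_transfer_swap_comp (hab : (a : ℕ) + 1 = b) (hf : ∀ i, Continuous (f i))
    (H : IsRunMax (fun z => f b z - f a z) S) (ht : f b t - f a t = S t) (hm : StrictMono m)
    (ha : a ∉ range m) (htx : t ≤ x) :
    sSup (weights (transfer a b S f) (Equiv.swap a b ∘ m) t x) = sSup (weights f m t x) := by
  rw [← sSup_weights_transfer hab hf H hm (fun h => absurd h ha) htx]
  refine (csSup_eq_csSup_of_isCofinalFor (weights_nonempty hm htx)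
    (weights_bddAbove ?_ m t x) (isCofinalFor_weights_swap_comp hab H ht hm ha)
    (weights_swap_comp_subset hab ha).isCofinalFor).symm
  exact continuous_transfer hf (H.continuous ((hf b).sub (hf a)))

theorem transfer_apply_of_record (hne : a ≠ b) (ht : f b t - f a t = S t) (i : Fin n) :
    transfer a b S f i t = f (Equiv.swap a b i) t := by
  rcases eq_or_ne i a with rfl | hia
  · rw [transfer_apply_left hne, Equiv.swap_apply_left, Pi.add_apply, ← ht, add_sub_cancel]
  · rcases eq_or_ne i b with rfl | hib
    · rw [transfer_apply_right hne, Equiv.swap_apply_right, Pi.sub_apply, ← ht, sub_sub_cancel]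
    · rw [transfer_apply_of_ne hia hib, Equiv.swap_apply_of_ne_of_ne hia hib]

theorem lppFrom_transfer (hab : (a : ℕ) + 1 = b) (hf : ∀ i, Continuous (f i))
    (H : IsRunMax (fun z => f b z - f a z) S) (ht : f b t - f a t = S t) (hm : StrictMono m)
    (hm' : StrictMono m') (hr : range m' = Equiv.swap a b '' range m)
    (h : a ∈ range m → b ∈ range m) (htx : t ≤ x) :
    lppFrom (transfer a b S f) m' x t = lppFrom f m x t := by
  have hne : a ≠ b := by rintro rfl; omega
  rw [lppFrom_eq _ _ htx, lppFrom_eq _ _ htx]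
  simp only [transfer_apply_of_record hne ht]
  have hsum : ∑ j, f (Equiv.swap a b (m' j)) t = ∑ j, f (m j) t :=
    sum_comp_eq_of_range_eq ((Equiv.swap a b).injective.comp hm'.injective) hm.injective
      (by rw [range_comp, hr, image_image]; simp) fun i => f i t
  rw [hsum]
  congr 1
  by_cases ha : a ∈ range m
  · have hswap : Equiv.swap a b '' range m = range m := (Equiv.swap_bijOn_self (by tauto)).image_eq
    obtain rfl : m' = m := (hm'.range_inj hm).1 (hr.trans hswap)
    exact sSup_weights_transfer hab hf H hm h htx
  · have hmono : StrictMono (Equiv.swap a b ∘ m) := fun i j hij =>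
      swap_lt_swap hab (hm hij) fun hi => absurd ⟨i, hi⟩ ha
    obtain rfl : m' = Equiv.swap a b ∘ m := (hm'.range_inj hmono).1 (hr.trans (range_comp _ _).symm)
    exact sSup_weights_transfer_swap_comp hab hf H ht hm ha htx

theorem hasLppFromBot_pitman_iff (hf : f ∈ C n) (hab : (a : ℕ) + 1 = b)
    (hlt : asympSlope f a < asympSlope f b) (hm : StrictMono m) (hm' : StrictMono m')
    (hr : range m' = Equiv.swap a b '' range m) (h : a ∈ range m → b ∈ range m) :
    HasLppFromBot (pitman a b f) m' x v ↔ HasLppFromBot f m x v := by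
  obtain ⟨S, H⟩ := exists_isRunMax_sub hf hlt
  have hS := H.continuous ((hf.1 b).sub (hf.1 a))
  have hrec : ∃ᶠ t in atBot, lppFrom (transfer a b S f) m' x t = lppFrom f m x t :=
    (H.frequently_eq.and_eventually (eventually_le_atBot x)).mono fun t ht =>
      lppFrom_transfer hab hf.1 H ht.1 hm hm' hr h ht.2
  rw [pitman_eq_transfer hlt H]
  exact ⟨tendsto_atBot_of_antitoneOn_of_frequently_eq (lppFrom_antitoneOn hf.1 hm x) hrec,
    tendsto_atBot_of_antitoneOn_of_frequently_eq
      (lppFrom_antitoneOn (continuous_transfer hf.1 hS) hm' x) (hrec.mono fun _ => Eq.symm)⟩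

theorem hasLppFromBot_firstLines (g : Env n) (hk : k ≤ n) (x : ℝ) :
    HasLppFromBot g (Fin.castLE hk) x (∑ i : Fin k, g (Fin.castLE hk i) x) := by
  refine tendsto_const_nhds.congr' ?_
  filter_upwards [eventually_le_atBot x] with t ht
  rw [lppFrom_eq _ _ ht, weights_firstLines g hk ht, csSup_singleton, ← Finset.sum_add_distrib]
  simp only [sub_add_cancel]

end FromBot

/-! ### Lines of largest slope -/

/-- The strict total order on the lines in which lines of larger slope come first, and lines of
equal slope come in increasing order. -/
def Precedes {α : Type*} [LT α] {n : ℕ} (lam : Fin n → α) (p q : Fin n) : Prop :=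
  lam q < lam p ∨ lam q = lam p ∧ p < q

/-- The entries of `m` are the first lines in the order `Precedes lam`: these are the starting lines
from which the last passage values are invariant under Pitman operators. -/
structure IsTop {α : Type*} [LT α] {n k : ℕ} (lam : Fin n → α) (m : Fin k → Fin n) : Prop where
  strictMono : StrictMono m
  precedes : ∀ p ∈ range m, ∀ q ∉ range m, Precedes lam p q

section Top

variable {α : Type*} {n k : ℕ} {a b : Fin n} {m m' : Fin k → Fin n}

theorem IsTop.mem_range_of_lt [Preorder α] {lam : Fin n → α} (hm : IsTop lam m)
    (hlt : lam a < lam b) (ha : a ∈ range m) : b ∈ range m := by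
  by_contra hb
  rcases hm.precedes a ha b hb with h | ⟨h, -⟩
  · exact h.asymm hlt
  · exact hlt.ne h.symm

theorem IsTop.swap [LT α] {lam : Fin n → α} (hm : IsTop lam m) (hab : (a : ℕ) + 1 = b)
    (hne : lam a ≠ lam b) (hm' : StrictMono m') (hr : range m' = Equiv.swap a b '' range m) :
    IsTop (lam ∘ Equiv.swap a b) m' := by
  refine ⟨hm', ?_⟩
  rw [hr]
  rintro _ ⟨p, hp, rfl⟩ q hq
  obtain ⟨q, rfl⟩ := (Equiv.swap a b).surjective q
  rw [(Equiv.swap a b).injective.mem_set_image] at hq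
  simp only [Precedes, Function.comp_apply, Equiv.swap_apply_self]
  refine (hm.precedes p hp q hq).imp_right fun ⟨heq, hpq⟩ => ⟨heq, swap_lt_swap hab hpq ?_⟩
  rintro rfl rfl
  exact hne heq.symm

theorem IsTop.unique [Preorder α] {lam : Fin n → α} (hm : IsTop lam m) (hm' : IsTop lam m') :
    m = m' := by
  rw [← hm.strictMono.range_inj hm'.strictMono]
  have hcard : (range m).ncard = (range m').ncard := by
    rw [ncard_range_of_injective hm.strictMono.injective,
      ncard_range_of_injective hm'.strictMono.injective]
  by_contra hne
  obtain ⟨p, hp, hp'⟩ := not_subset.1 fun h => hne (eq_of_subset_of_ncard_le h hcard.ge)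
  obtain ⟨q, hq', hq⟩ := not_subset.1 fun h => hne (eq_of_subset_of_ncard_le h hcard.le).symm
  rcases hm.precedes p hp q hq, hm'.precedes q hq' p hp' with ⟨h | h, h' | h'⟩
  · exact h.asymm h'
  · exact h.ne h'.1.symm
  · exact h'.ne h.1.symm
  · exact h.2.asymm h'.2

theorem exists_strictMono_range_eq [LinearOrder α] {u : Fin k → α} (hu : Function.Injective u) :
    ∃ u' : Fin k → α, StrictMono u' ∧ range u' = range u :=
  ⟨u ∘ Tuple.sort u, (Tuple.monotone_sort u).strictMono_of_injective
    (hu.comp (Tuple.sort u).injective), EquivLike.range_comp u (Tuple.sort u)⟩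

theorem IsTop.exists_swap [LT α] {lam : Fin n → α} (hm : IsTop lam m) (hab : (a : ℕ) + 1 = b)
    (hne : lam a ≠ lam b) :
    ∃ m' : Fin k → Fin n, IsTop (lam ∘ Equiv.swap a b) m' ∧
      range m' = Equiv.swap a b '' range m := by
  obtain ⟨m', hm', hr⟩ := exists_strictMono_range_eq
    ((Equiv.swap a b).injective.comp hm.strictMono.injective)
  rw [range_comp] at hr
  exact ⟨m', hm.swap hab hne hm' hr, hr⟩

theorem isTop_firstLines [PartialOrder α] {lam : Fin n → α} (hlam : Antitone lam) (hk : k ≤ n) :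
    IsTop lam (Fin.castLE hk) := by
  refine ⟨Fin.strictMono_castLE hk, ?_⟩
  rintro _ ⟨j, rfl⟩ q hq
  have hlt : Fin.castLE hk j < q :=
    not_le.1 fun h => hq ⟨⟨q, (Fin.le_def.1 h).trans_lt j.2⟩, rfl⟩
  exact (hlam hlt.le).lt_or_eq.imp_right fun heq => ⟨heq, hlt⟩

theorem isTop_lastLines [Preorder α] {lam : Fin n → α} (hlam : StrictMono lam) (hk : k ≤ n) :
    IsTop lam (lastLines n k hk) := by
  refine ⟨fun i j hij => Fin.lt_def.2 (Nat.add_lt_add_left hij _), ?_⟩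
  rintro _ ⟨j, rfl⟩ q hq
  refine Or.inl (hlam (not_le.1 fun h => hq ?_))
  have hq' : n - k + j ≤ q := h
  exact ⟨⟨q - (n - k), by omega⟩, Fin.ext (by simp only [lastLines]; omega)⟩

theorem apply_le_apply_of_forall_mem_range {ι : Type*} [LinearOrder ι] [WellFoundedGT ι]
    [LinearOrder α] {u v : ι → α} (hu : StrictMono u) (hv : StrictMono v) {j : ι}
    (h : ∀ l, j ≤ l → u l ∈ range v) : u j ≤ v j := by
  by_contra! hlt
  choose φ hφ using h
  have hjφ : ∀ l hl, j < φ l hl := fun l hl =>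
    hv.lt_iff_lt.1 (by rw [hφ]; exact hlt.trans_le (hu.monotone hl))
  have hφ_lt : ∀ l l' hl hl', l < l' → φ l hl < φ l' hl' := fun l l' hl hl' hll' =>
    hv.lt_iff_lt.1 (by rw [hφ, hφ]; exact hu hll')
  have hmono : StrictMono fun l : Ici j => (⟨φ l l.2, (hjφ l l.2).le⟩ : Ici j) :=
    fun _ _ hll' => hφ_lt _ _ _ _ hll'
  exact (hjφ j le_rfl).not_ge (hmono.apply_le (x := ⟨j, le_rfl⟩))

variable {lam : Fin n → ℝ}

theorem mem_range_of_mem_admissible (hlam : Monotone lam) (hm : m ∈ admissible lam k) {p q : Fin n}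
    (hp : p ∈ range m) (hqp : q ≤ p) (heq : lam q = lam p) : q ∈ range m := by
  obtain ⟨r, ⟨hr, hqr, hrp⟩, hmin⟩ :=
    (toFinite (range m ∩ Icc q p)).exists_minimal ⟨p, hp, hqp, le_rfl⟩
  rcases hqr.eq_or_lt with rfl | hlt
  · exact hr
  obtain ⟨s, hs⟩ : ∃ s : Fin n, (s : ℕ) + 1 = r := ⟨⟨r - 1, by omega⟩, by simp; omega⟩
  have hqs : q ≤ s := by omega
  have hsr : s < r := by omega
  have hs_notMem : s ∉ range m := fun h => (hmin ⟨h, hqs, hsr.le.trans hrp⟩ hsr.le).not_gt hsr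
  have := hm.2 r s hs hr hs_notMem
  linarith [hlam hqs, hlam hrp]

theorem IsTop.isGreatest (hm : IsTop lam m) (hlam : Monotone lam) :
    IsGreatest (admissible lam k) m := by
  refine ⟨⟨hm.strictMono, fun p q hqp hp hq => ?_⟩, fun m' hm' j => ?_⟩
  · exact (hm.precedes p hp q hq).resolve_right fun h => by omega
  by_contra! hlt
  obtain ⟨l, hjl, hl⟩ : ∃ l, j ≤ l ∧ m' l ∉ range m := by
    by_contra! h
    exact hlt.not_ge (apply_le_apply_of_forall_mem_range hm'.1 hm.strictMono h)
  refine hlt.not_ge (apply_le_apply_of_forall_mem_range (ι := (Fin k)ᵒᵈ) (α := (Fin n)ᵒᵈ)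
    hm.strictMono.dual hm'.1.dual fun i hij => ?_)
  have hil : m i ≤ m' l :=
    (hm.strictMono.monotone hij).trans (hlt.le.trans (hm'.1.monotone hjl))
  have heq := (hm.precedes _ ⟨i, rfl⟩ _ hl).resolve_left (hlam hil).not_gt
  exact mem_range_of_mem_admissible hlam hm' ⟨l, rfl⟩ hil heq.1.symm

end Top

/-! ### Greene's theorem -/

/-- The last passage values from the `k` lines of largest slope exist and are given by `v`. -/
def HasTopLpp {n : ℕ} (f : Env n) (k : ℕ) (v : ℝ → ℝ) : Prop :=
  ∃ m : Fin k → Fin n, IsTop (asympSlope f) m ∧ ∀ x, HasLppFromBot f m x (v x)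

section Greene

variable {n k : ℕ} {f g : Env n} {a b : Fin n}

theorem hasTopLpp_pitman_iff (hf : f ∈ C n) (hab : (a : ℕ) + 1 = b)
    (hlt : asympSlope f a < asympSlope f b) {v : ℝ → ℝ} :
    HasTopLpp (pitman a b f) k v ↔ HasTopLpp f k v := by
  have hpitman : ∀ {m m' : Fin k → Fin n}, IsTop (asympSlope f) m → StrictMono m' →
      range m' = Equiv.swap a b '' range m → ∀ x,
      (HasLppFromBot (pitman a b f) m' x (v x) ↔ HasLppFromBot f m x (v x)) :=
    fun hm hm' hr x => hasLppFromBot_pitman_iff hf hab hlt hm.strictMono hm' hr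
      (hm.mem_range_of_lt hlt)
  have hswap : asympSlope (pitman a b f) ∘ Equiv.swap a b = asympSlope f := by
    rw [asympSlope_pitman hf hlt]
    funext i
    simp
  constructor
  · rintro ⟨m', hm', h⟩
    obtain ⟨m, hm, hr⟩ := hm'.exists_swap hab (by simpa [asympSlope_pitman hf hlt] using hlt.ne')
    rw [hswap] at hm
    have hr' : range m' = Equiv.swap a b '' range m := by
      rw [hr, image_image]
      simp
    exact ⟨m, hm, fun x => (hpitman hm hm'.strictMono hr' x).1 (h x)⟩
  · rintro ⟨m, hm, h⟩
    obtain ⟨m', hm', hr⟩ := hm.exists_swap hab hlt.ne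
    rw [← asympSlope_pitman hf hlt] at hm'
    exact ⟨m', hm', fun x => (hpitman hm hm'.strictMono hr x).2 (h x)⟩

theorem hasTopLpp_of_mem_orbit (hf : f ∈ C n) (hg : g ∈ orbit f) (hg' : g ∈ CGE n) (hk : k ≤ n) :
    HasTopLpp f k fun x => ∑ i : Fin k, g (Fin.castLE hk i) x :=
  (iff_of_mem_orbit (p := fun f => HasTopLpp f k fun x => ∑ i : Fin k, g (Fin.castLE hk i) x) hf
    (fun _ hg _ _ hab hlt => (hasTopLpp_pitman_iff hg hab hlt).symm) hg).2
    ⟨_, isTop_firstLines hg'.2 hk, hasLppFromBot_firstLines g hk⟩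

theorem sum_castLE_succ_sub_sum_castLE (g : Env n) (i : Fin n) (x : ℝ) :
    ∑ j : Fin ((i : ℕ) + 1), g (Fin.castLE i.isLt j) x -
      ∑ j : Fin (i : ℕ), g (Fin.castLE i.isLt.le j) x = g i x := by
  rw [Fin.sum_univ_castSucc]
  exact add_sub_cancel_left _ _

theorem eq_of_mem_orbit_of_mem_CGE (hf : f ∈ CGE n) (hg : g ∈ CGE n) (hfg : g ∈ orbit f) :
    g = f := by
  have hsum : ∀ (k : ℕ) (hk : k ≤ n) (x : ℝ),
      ∑ i : Fin k, g (Fin.castLE hk i) x = ∑ i : Fin k, f (Fin.castLE hk i) x := by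
    intro k hk x
    obtain ⟨m, hm, h⟩ := hasTopLpp_of_mem_orbit hf.1 hfg hg hk
    obtain rfl := hm.unique (isTop_firstLines hf.2 hk)
    exact tendsto_nhds_unique (h x) (hasLppFromBot_firstLines f hk x)
  funext i x
  rw [← sum_castLE_succ_sub_sum_castLE g, ← sum_castLE_succ_sub_sum_castLE f, hsum, hsum]

end Greene

/-! ### The RSK correspondence -/

section RSK

variable {n k : ℕ} {f g : Env n}

theorem existsUnique_mem_CGE (hf : f ∈ C n) : ∃! g, g ∈ orbit f ∧ g ∈ CGE n := by
  obtain ⟨g, hfg, hg⟩ := exists_mem_orbit_mem_CGE hf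
  exact ⟨g, ⟨hfg, hg⟩, fun e he =>
    eq_of_mem_orbit_of_mem_CGE hg he.2 (orbit_trans (orbit_symm hf hfg) he.1)⟩

theorem R_mem_orbit_of_mem_orbit_R (hg : g ∈ orbit (R f)) : R g ∈ orbit f := by
  simpa only [R_R] using R_mem_orbit hg

theorem existsUnique_mem_CLE (hf : f ∈ C n) : ∃! g, g ∈ orbit f ∧ g ∈ CLE n := by
  obtain ⟨g, ⟨hfg, hg⟩, hunique⟩ := existsUnique_mem_CGE (R_mem_C hf)
  refine ⟨R g, ⟨R_mem_orbit_of_mem_orbit_R hfg, R_mem_CLE hg⟩, fun e he => ?_⟩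
  rw [← hunique (R e) ⟨R_mem_orbit he.1, R_mem_CGE he.2⟩, R_R]

theorem PRSK_mem (hf : f ∈ C n) : PRSK f ∈ orbit f ∧ PRSK f ∈ CGE n :=
  Classical.epsilon_spec (existsUnique_mem_CGE hf).exists

theorem QRSK_mem (hf : f ∈ C n) : QRSK f ∈ orbit f ∧ QRSK f ∈ CLE n :=
  Classical.epsilon_spec (existsUnique_mem_CLE hf).exists

theorem QRSK_PRSK (hf : f ∈ CLE n) : QRSK (PRSK f) = f := by
  obtain ⟨horbit, hC, -⟩ := PRSK_mem hf.1
  exact (existsUnique_mem_CLE hC).unique (QRSK_mem hC) ⟨orbit_symm hf.1 horbit, hf⟩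

theorem PRSK_QRSK (hg : g ∈ CGE n) : PRSK (QRSK g) = g := by
  obtain ⟨horbit, hC, -⟩ := QRSK_mem hg.1
  exact (existsUnique_mem_CGE hC).unique (PRSK_mem hC) ⟨orbit_symm hg.1 horbit, hg⟩

theorem invOn_QRSK_PRSK (n : ℕ) : InvOn QRSK PRSK (CLE n) (CGE n) :=
  ⟨fun _ => QRSK_PRSK, fun _ => PRSK_QRSK⟩

theorem QRSK_eq (hf : f ∈ C n) : QRSK f = R (PRSK (R f)) := by
  obtain ⟨horbit, hCGE⟩ := PRSK_mem (R_mem_C hf)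
  exact (existsUnique_mem_CLE hf).unique (QRSK_mem hf)
    ⟨R_mem_orbit_of_mem_orbit_R horbit, R_mem_CLE hCGE⟩

theorem PRSK_R_PRSK (hf : f ∈ CLE n) : PRSK (R (PRSK f)) = R f := by
  rw [← R_R (PRSK _), ← QRSK_eq (PRSK_mem hf.1).2.1, QRSK_PRSK hf]

theorem asympSlope_PRSK (hf : f ∈ CLE n) :
    asympSlope (PRSK f) = fun i => asympSlope f (Fin.rev i) := by
  obtain ⟨horbit, hCGE⟩ := PRSK_mem hf.1
  obtain ⟨σ, hσ⟩ := exists_perm_of_mem_orbit hf.1 horbit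
  have hmono : Monotone (asympSlope f ∘ (σ * Fin.revPerm : Equiv.Perm (Fin n))) := by
    rw [Equiv.Perm.coe_mul, ← Function.comp_assoc, ← hσ]
    exact hCGE.2.comp fun i j => Fin.rev_le_rev.2
  have heq := Tuple.unique_monotone (σ := σ * Fin.revPerm) (τ := 1) hmono hf.2
  rw [hσ]
  funext i
  simpa using congrFun heq (Fin.rev i)

theorem exists_isGreatest_hasLppFromBot (hf : f ∈ CLE n) (hk : k ≤ n) :
    ∃ m : Fin k → Fin n, IsGreatest (admissible (asympSlope f) k) m ∧
      ∀ x, HasLppFromBot f m x (∑ i : Fin k, PRSK f (Fin.castLE hk i) x) := by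
  obtain ⟨m, hm, h⟩ := hasTopLpp_of_mem_orbit hf.1 (PRSK_mem hf.1).1 (PRSK_mem hf.1).2 hk
  exact ⟨m, hm.isGreatest hf.2, h⟩

theorem exists_isGreatest_hasLppFromBot_R_PRSK (hf : f ∈ CLE n) (hk : k ≤ n) :
    ∃ m : Fin k → Fin n, IsGreatest (admissible (fun i => -asympSlope f (Fin.rev i)) k) m ∧
      ∀ x, HasLppFromBot (R (PRSK f)) m (-x) (∑ i : Fin k, f (Fin.castLE hk i) x) := by
  have hg := (PRSK_mem hf.1).2
  obtain ⟨m, hm, h⟩ := exists_isGreatest_hasLppFromBot (R_mem_CLE hg) hk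
  rw [asympSlope_R hg.1, asympSlope_PRSK hf] at hm
  refine ⟨m, hm, fun x => ?_⟩
  simpa [PRSK_R_PRSK hf, R] using h (-x)

theorem CLT_subset_CLE (n : ℕ) : CLT n ⊆ CLE n := fun _ h => ⟨h.1, h.2.monotone⟩

theorem CGT_subset_CGE (n : ℕ) : CGT n ⊆ CGE n := fun _ h => ⟨h.1, h.2.antitone⟩

theorem PRSK_mem_CGT (hf : f ∈ CLT n) : PRSK f ∈ CGT n := by
  refine ⟨(PRSK_mem hf.1).2.1, ?_⟩
  rw [asympSlope_PRSK (CLT_subset_CLE n hf)]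
  exact fun i j hij => hf.2 (Fin.rev_lt_rev.2 hij)

theorem QRSK_mem_CLT (hg : g ∈ CGT n) : QRSK g ∈ CLT n := by
  rw [QRSK_eq hg.1]
  exact R_mem_CLT (PRSK_mem_CGT (R_mem_CLT hg))

theorem hasLppFromBot_lastLines (hf : f ∈ CLT n) (hk : k ≤ n) (x : ℝ) :
    HasLppFromBot f (lastLines n k hk) x (∑ i : Fin k, PRSK f (Fin.castLE hk i) x) := by
  obtain ⟨m, hm, h⟩ := hasTopLpp_of_mem_orbit hf.1 (PRSK_mem hf.1).1 (PRSK_mem hf.1).2 hk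
  obtain rfl := hm.unique (isTop_lastLines hf.2 hk)
  exact h x

theorem W_eq_PRSK (hf : f ∈ CLT n) : W f = PRSK f := by
  funext i x
  rw [W, (hasLppFromBot_lastLines hf i.isLt x).limUnder_eq,
    (hasLppFromBot_lastLines hf i.isLt.le x).limUnder_eq, sum_castLE_succ_sub_sum_castLE]

theorem R_W_R_eq_QRSK (hg : g ∈ CGT n) : R (W (R g)) = QRSK g := by
  rw [W_eq_PRSK (R_mem_CLT hg), QRSK_eq hg.1]

theorem mapsTo_W (n : ℕ) : MapsTo W (CLT n) (CGT n) := fun f hf => by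
  rw [W_eq_PRSK hf]
  exact PRSK_mem_CGT hf

theorem mapsTo_R_W_R (n : ℕ) : MapsTo (fun g => R (W (R g))) (CGT n) (CLT n) := fun g hg => by
  beta_reduce
  rw [R_W_R_eq_QRSK hg]
  exact QRSK_mem_CLT hg

theorem invOn_R_W_R_W (n : ℕ) : InvOn (fun g => R (W (R g))) W (CLT n) (CGT n) := by
  constructor
  · intro f hf
    beta_reduce
    rw [W_eq_PRSK hf, R_W_R_eq_QRSK (PRSK_mem_CGT hf), QRSK_PRSK (CLT_subset_CLE n hf)]
  · intro g hg
    beta_reduce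
    rw [R_W_R_eq_QRSK hg, W_eq_PRSK (QRSK_mem_CLT hg), PRSK_QRSK (CGT_subset_CGE n hg)]

end RSK

end RSKLine

open RSKLine in
theorem corollaryC (n : ℕ) :
    -- `PRSK` and `QRSK` are well defined
    (∀ f ∈ CLE n, (∃! g, g ∈ orbit f ∧ g ∈ CGE n) ∧ PRSK f ∈ orbit f ∧ PRSK f ∈ CGE n) ∧
    (∀ g ∈ CGE n, (∃! f, f ∈ orbit g ∧ f ∈ CLE n) ∧ QRSK g ∈ orbit g ∧ QRSK g ∈ CLE n) ∧
    -- they are mutually inverse bijections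
    Set.BijOn PRSK (CLE n) (CGE n) ∧
    Set.BijOn QRSK (CGE n) (CLE n) ∧
    Set.InvOn QRSK PRSK (CLE n) (CGE n) ∧
    -- `QRSK = R PRSK R`, and `PRSK R` is an involution of `CGE n`
    (∀ g ∈ CGE n, QRSK g = R (PRSK (R g))) ∧
    Set.MapsTo (fun g => PRSK (R g)) (CGE n) (CGE n) ∧
    (∀ g ∈ CGE n, PRSK (R (PRSK (R g))) = g) ∧
    -- last passage formulas for `g = PRSK f` in terms of `f` and for `f` in terms of `R g`
    (∀ f ∈ CLE n, ∀ (k : ℕ) (hk : k ≤ n),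
      (∃ nk : Fin k → Fin n, IsGreatest (admissible (asympSlope f) k) nk ∧
        ∀ x : ℝ, HasLppFromBot f nk x (∑ i : Fin k, PRSK f (Fin.castLE hk i) x)) ∧
      (∃ mk : Fin k → Fin n,
        IsGreatest (admissible (fun i => -asympSlope f (Fin.rev i)) k) mk ∧
        ∀ x : ℝ, HasLppFromBot (R (PRSK f)) mk (-x) (∑ i : Fin k, f (Fin.castLE hk i) x))) ∧
    -- for strictly increasing slopes: the formula defining `W` makes sense, `W = PRSK`, and
    -- `W` is a bijection with inverse `R W R`
    (∀ f ∈ CLT n, ∀ (k : ℕ) (hk : k ≤ n) (x : ℝ),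
      HasLppFromBot f (lastLines n k hk) x (∑ i : Fin k, W f (Fin.castLE hk i) x)) ∧
    (∀ f ∈ CLT n, W f = PRSK f) ∧
    Set.BijOn W (CLT n) (CGT n) ∧
    Set.BijOn (fun g => R (W (R g))) (CGT n) (CLT n) ∧
    Set.InvOn (fun g => R (W (R g))) W (CLT n) (CGT n) := by
  have hP : MapsTo PRSK (CLE n) (CGE n) := fun f hf => (PRSK_mem hf.1).2
  have hQ : MapsTo QRSK (CGE n) (CLE n) := fun g hg => (QRSK_mem hg.1).2
  refine ⟨fun f hf => ⟨existsUnique_mem_CGE hf.1, PRSK_mem hf.1⟩,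
    fun g hg => ⟨existsUnique_mem_CLE hg.1, QRSK_mem hg.1⟩,
    (invOn_QRSK_PRSK n).bijOn hP hQ, (invOn_QRSK_PRSK n).symm.bijOn hQ hP, invOn_QRSK_PRSK n,
    fun g hg => QRSK_eq hg.1, fun g hg => hP (R_mem_CLE hg), fun g hg => ?_,
    fun f hf k hk => ⟨exists_isGreatest_hasLppFromBot hf hk,
      exists_isGreatest_hasLppFromBot_R_PRSK hf hk⟩,
    fun f hf k hk x => ?_, fun f hf => W_eq_PRSK hf,
    (invOn_R_W_R_W n).bijOn (mapsTo_W n) (mapsTo_R_W_R n),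
    (invOn_R_W_R_W n).symm.bijOn (mapsTo_R_W_R n) (mapsTo_W n), invOn_R_W_R_W n⟩
  · rw [PRSK_R_PRSK (R_mem_CLE hg), R_R]
  · rw [W_eq_PRSK hf]
    exact hasLppFromBot_lastLines hf hk x
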